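/- On $M=\mathbb C^{12}$ with coordinates $(b_i,a_i,c_i)_{i=1,\dots,4}$ (indices mod 4) let $P$ be the linear Poisson tensor whose nonzero brackets $P^{st}=\{x^s,x^t\}$ are, up to antisymmetry, $\{b_i,a_i\}=-a_i$, $\{b_{i+1},a_i\}=a_i$, $\{b_i,c_i\}=-c_i$, $\{b_{i+2},c_i\}=c_i$, $\{a_i,a_{i+1}\}=-c_i$, and let $P'$ be the quadratic Poisson tensor with, for all $i$ (again up to antisymmetry, other brackets being zero), $\{b_i,b_{i+1}\}'=a_i$; $\{b_i,a_i\}'=-b_ia_i$, $\{b_{i+1},a_i\}'=b_{i+1}a_i$, $\{b_i,a_{i+1}\}'=c_i$, $\{b_i,a_{i+2}\}'=-c_{i+2}$; $\{a_i,a_{i+1}\}'=-b_{i+1}c_i-a_ia_{i+1}$; $\{b_i,c_i\}'=-b_ic_i$, $\{b_{i+2},c_i\}'=b_{i+2}c_i$; $\{a_i,c_i\}'=-a_ic_i$, $\{a_i,c_{i+1}\}'=-a_ic_{i+1}$, $\{a_i,c_{i+2}\}'=a_ic_{i+2}$, $\{a_i,c_{i+3}\}'=a_ic_{i+3}$; $\{c_i,c_{i+1}\}'=-c_ic_{i+1}$.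 Brackets are $\{f,g\}=\langle df,P\,dg\rangle$. Let $$L(\nu)=\begin{pmatrix} b_1&-\nu&c_3/\nu^2&a_4/\nu\\ a_1/\nu&b_2&-\nu&c_4/\nu^2\\ c_1/\nu^2&a_2/\nu&b_3&-\nu\\ -\nu&c_2/\nu^2&a_3/\nu&b_4\end{pmatrix}.$$ With $\rho=\nu^4$ one has $$\det(x\mathbf 1-L(\nu))=R(x,\rho)=x^4-\rho+H(x)+\frac{K(x)-x^2J_1}{\rho}+\frac{J_2}{\rho^2},$$ $$H(x)=-x^3H_0+x^2H_1-xH_2+H_3,\qquad K(x)=xK_0+K_1,$$ where $H_0=\sum b_i$, $J_1=c_1c_3+c_2c_4$, $J_2=c_1c_2c_3c_4$, and the Toda$^4_3$ Hamiltonian is $H_{GT}=\frac12\sum b_i^2-\sum a_i=\frac12H_0^2-H_1$. Let $S_\kappa$ be the level sets $(H_0,K_0,J_1,J_2)=\kappa\in\mathbb C^4$. Put $Z_1=-\partial_{b_4}$, $Z_2=\partial_{a_4}$, $(F_1,F_2)=(H_0,K_0)$, $G_{ij}=L_{Z_i}F_j$ and $Q=P'-\sum_{i,j}(G^{-1})_{ji}\,Z_i\wedge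 P'dF_j$, with $(Z\wedge X)\alpha=\alpha(Z)X-\alpha(X)Z$. Let $$\mathcal G(x)=\begin{pmatrix}L_{Z_1}H(x)&L_{Z_2}H(x)\\ L_{Z_1}K(x)&L_{Z_2}K(x)\end{pmatrix},\qquad \rho(x)=-\mathcal G_{22}(x)/\mathcal G_{12}(x).$$ Let $U\subset M$ be the set of points where $G$ is invertible, $\det\mathcal G(x)$ has four distinct roots $\lambda_1,\dots,\lambda_4$, at each of which $\mathcal G_{12}$ and $\mathcal G_{22}$ do not vanish, and the differentials of $H_0,K_0,J_1,J_2,H_1,H_2,H_3,K_1$ are linearly independent. Let $\mu_i=\log\rho(\lambda_i)$ (local holomorphic branches). **Proposition.** There is a nonzero polynomial $E$ on $\mathbb C^4$ such that, whenever $E(\kappa)\ne0$, $S_\kappa$ is nonempty, the differentials of $H_0,K_0,J_1,J_2$ are independent at every point of $S_\kappa$, the image of $P$ there is the tangent space of $S_\kappa$ (so $S_\kappa$ is an $8$-dimensional manifold on which $P$ is symplectic), and $S_\kappa\cap U$ is dense in $S_\kappa$. For every $\kappa$, near each point of $S_\kappa\cap U$ holomorphic branches of $(\lambda_i,\mu_i)$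 exist and form a chart of $S_\kappa$, and for any choice of branches the following holds at the points of $S_\kappa\cap U$ in their domain. 1. $P$ is nondegenerate on $S_\kappa$, and $H_1,H_2,H_3,K_1$ are in involution and have independent differentials on $S_\kappa$. 2. $(\lambda_i,\mu_i)$ are Darboux--Nijenhuis coordinates: they are local coordinates on $S_\kappa$, $\{\mu_i,\lambda_j\}=\delta_{ij}$, $\{\lambda_i,\lambda_j\}=\{\mu_i,\mu_j\}=0$, and $N=QP^{-1}$ is a well-defined operator on the tangent spaces of $S_\kappa$ with $d\lambda_i\circ N=\lambda_i\,d\lambda_i$ and $d\mu_i\circ N=\lambda_i\,d\mu_i$. 3. The system is separable in $(\lambda_i,\mu_i)$, the separation relations being the evaluation of the spectral curve at $x=\lambda_i$, $\rho=e^{\mu_i}$: for $i=1,\dots,4$, $\det(\lambda_i\mathbf 1-L(\nu))=0$ whenever $\nu^4=e^{\mu_i}$, that is, $$\Phi(\lambda_i,\mu_i;H_1,H_2,H_3,K_1)=0,$$ where $\Phi(x,y;h)$ is $R(x,e^y)$ with the Casimirs replaced by their values $\kappa$ and $(H_1,H_2,H_3,K_1)$ by $h$. These relations are nontrivial: $(\partial_x\Phi,\partial_y\Phi)\neq0$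 at each $(\lambda_i,\mu_i)$, and the $4\times4$ matrix $\big(\partial\Phi/\partial h_j(\lambda_i,\mu_i;H)\big)_{ij}$ is invertible. -/

import Mathlib

open Matrix

noncomputable section

namespace TodaFourThree

/-! ### Phase space `ℂ¹²` with coordinates `(b, a, c)` (indices `0, 1, 2, 3`, cyclic) -/

/-- Labels of the coordinates: `inl i` is `b_i`, `inr (inl i)` is `a_i`, `inr (inr i)` is `c_i`. -/
abbrev Idx := Fin 4 ⊕ (Fin 4 ⊕ Fin 4)

/-- The phase space `ℂ¹²`. -/
abbrev Phase := Idx → ℂ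

def bc (m : Phase) (i : Fin 4) : ℂ := m (Sum.inl i)
def ac (m : Phase) (i : Fin 4) : ℂ := m (Sum.inr (Sum.inl i))
def cc (m : Phase) (i : Fin 4) : ℂ := m (Sum.inr (Sum.inr i))

/-! ### The two Poisson tensors -/

def blockA1 (a : Fin 4 → ℂ) : Matrix (Fin 4) (Fin 4) ℂ :=
  !![-a 0, 0, 0, a 3;
     a 0, -a 1, 0, 0;
     0, a 1, -a 2, 0;
     0, 0, a 2, -a 3]

def blockC1 (c : Fin 4 → ℂ) : Matrix (Fin 4) (Fin 4) ℂ :=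
  !![-c 0, 0, c 2, 0;
     0, -c 1, 0, c 3;
     c 0, 0, -c 2, 0;
     0, c 1, 0, -c 3]

def blockC2 (c : Fin 4 → ℂ) : Matrix (Fin 4) (Fin 4) ℂ :=
  !![0, -c 0, 0, c 3;
     c 0, 0, -c 1, 0;
     0, c 1, 0, -c 2;
     -c 3, 0, c 2, 0]

/-- The linear Poisson tensor `P`; the entry `(s, t)` is the bracket of the coordinates `s`, `t`. -/
def bivP (m : Phase) : Matrix Idx Idx ℂ :=
  Matrix.fromBlocks 0 (Matrix.fromCols (blockA1 (ac m)) (blockC1 (cc m)))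
    (Matrix.fromRows (-(blockA1 (ac m))ᵀ) (-(blockC1 (cc m))ᵀ))
    (Matrix.fromBlocks (blockC2 (cc m)) 0 0 0)

def blockA2 (a : Fin 4 → ℂ) : Matrix (Fin 4) (Fin 4) ℂ :=
  !![0, a 0, 0, -a 3;
     -a 0, 0, a 1, 0;
     0, -a 1, 0, a 2;
     a 3, 0, -a 2, 0]

def blockB1 (b a c : Fin 4 → ℂ) : Matrix (Fin 4) (Fin 4) ℂ :=
  !![-(b 0 * a 0), c 0, -c 2, b 0 * a 3;
     b 1 * a 0, -(b 1 * a 1), c 1, -c 3;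
     -c 0, b 2 * a 1, -(b 2 * a 2), c 2;
     c 3, -c 1, b 3 * a 2, -(b 3 * a 3)]

def blockC3 (b c : Fin 4 → ℂ) : Matrix (Fin 4) (Fin 4) ℂ :=
  !![-(b 0 * c 0), 0, b 0 * c 2, 0;
     0, -(b 1 * c 1), 0, b 1 * c 3;
     c 0 * b 2, 0, -(b 2 * c 2), 0;
     0, c 1 * b 3, 0, -(b 3 * c 3)]

def blockA3 (b a c : Fin 4 → ℂ) : Matrix (Fin 4) (Fin 4) ℂ :=
  !![0, -(b 1 * c 0) - a 0 * a 1, 0, b 0 * c 3 + a 0 * a 3;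
     b 1 * c 0 + a 0 * a 1, 0, -(b 2 * c 1) - a 1 * a 2, 0;
     0, b 2 * c 1 + a 1 * a 2, 0, -(b 3 * c 2) - a 2 * a 3;
     -(b 0 * c 3) - a 0 * a 3, 0, b 3 * c 2 + a 2 * a 3, 0]

def blockC4 (a c : Fin 4 → ℂ) : Matrix (Fin 4) (Fin 4) ℂ :=
  !![-(a 0 * c 0), -(a 0 * c 1), a 0 * c 2, a 0 * c 3;
     c 0 * a 1, -(a 1 * c 1), -(a 1 * c 2), a 1 * c 3;
     c 0 * a 2, c 1 * a 2, -(a 2 * c 2), -(a 2 * c 3);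
     -(c 0 * a 3), c 1 * a 3, c 2 * a 3, -(a 3 * c 3)]

def blockA4 (c : Fin 4 → ℂ) : Matrix (Fin 4) (Fin 4) ℂ :=
  !![0, -(c 0 * c 1), 0, c 0 * c 3;
     c 0 * c 1, 0, -(c 1 * c 2), 0;
     0, c 1 * c 2, 0, -(c 2 * c 3);
     -(c 0 * c 3), 0, c 2 * c 3, 0]

/-- The second Poisson tensor `P'`. -/
def bivP' (m : Phase) : Matrix Idx Idx ℂ :=
  Matrix.fromBlocks (blockA2 (ac m))
    (Matrix.fromCols (blockB1 (bc m) (ac m) (cc m)) (blockC3 (bc m) (cc m)))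
    (Matrix.fromRows (-(blockB1 (bc m) (ac m) (cc m))ᵀ) (-(blockC3 (bc m) (cc m))ᵀ))
    (Matrix.fromBlocks (blockA3 (bc m) (ac m) (cc m)) (blockC4 (ac m) (cc m))
      (-(blockC4 (ac m) (cc m))ᵀ) (blockA4 (cc m)))

/-- The vector `B α` obtained by applying the bivector `B` to the covector `α`. -/
def sharp (B : Matrix Idx Idx ℂ) (α : Phase →L[ℂ] ℂ) : Phase :=
  B *ᵥ fun t => α (Pi.single t 1)

/-- The bracket `{f, g} = ⟨df, B dg⟩` at the point `m`. -/
def bracket (B : Phase → Matrix Idx Idx ℂ) (f g : Phase → ℂ) (m : Phase) : ℂ :=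
  fderiv ℂ f m (sharp (B m) (fderiv ℂ g m))

/-! ### Lax matrix, Hamiltonians and Casimirs -/

/-- The Hamiltonian of the `Toda^4_3` system. -/
def todaH (m : Phase) : ℂ := (1 / 2) * ∑ i, bc m i ^ 2 - ∑ i, ac m i

/-- The Lax matrix `L(ν)` with spectral parameter `ν`. -/
def lax (m : Phase) (ν : ℂ) : Matrix (Fin 4) (Fin 4) ℂ :=
  !![bc m 0, -ν, cc m 2 / ν ^ 2, ac m 3 / ν;
     ac m 0 / ν, bc m 1, -ν, cc m 3 / ν ^ 2;
     cc m 0 / ν ^ 2, ac m 1 / ν, bc m 2, -ν;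
     -ν, cc m 1 / ν ^ 2, ac m 2 / ν, bc m 3]

def H0 (m : Phase) : ℂ := ∑ i, bc m i

def H1 (m : Phase) : ℂ :=
  bc m 0 * bc m 1 + bc m 0 * bc m 2 + bc m 0 * bc m 3
    + bc m 1 * bc m 2 + bc m 1 * bc m 3 + bc m 2 * bc m 3 + ∑ i, ac m i

def H2 (m : Phase) : ℂ :=
  ∑ i, (cc m i + bc m i * (ac m (i + 1) + ac m (i + 2)) + bc m i * bc m (i + 1) * bc m (i + 2))

def H3 (m : Phase) : ℂ :=
  ∑ i, (bc m i * cc m (i + 1) + ac m i * bc m (i + 2) * bc m (i + 3))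
    + ac m 0 * ac m 2 + ac m 1 * ac m 3 + bc m 0 * bc m 1 * bc m 2 * bc m 3

def K0 (m : Phase) : ℂ :=
  ∑ i, (bc m i * cc m (i + 3) * cc m (i + 1) - cc m i * ac m (i + 3) * ac m (i + 2))

def K1 (m : Phase) : ℂ :=
  ∑ i, (ac m i * cc m (i + 1) * cc m (i + 2) + cc m i * bc m (i + 1) * ac m (i + 2) * ac m (i + 3))
    - ac m 0 * ac m 1 * ac m 2 * ac m 3
    - cc m 0 * cc m 2 * bc m 1 * bc m 3 - cc m 1 * cc m 3 * bc m 0 * bc m 2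

def J1 (m : Phase) : ℂ := cc m 0 * cc m 2 + cc m 1 * cc m 3

def J2 (m : Phase) : ℂ := cc m 0 * cc m 1 * cc m 2 * cc m 3

/-- The Casimirs `(H₀, K₀, J₁, J₂)` of `P`. -/
def casimirs (m : Phase) : Fin 4 → ℂ := ![H0 m, K0 m, J1 m, J2 m]

/-- The nontrivial Hamiltonians `(H₁, H₂, H₃, K₁)`. -/
def hams (m : Phase) : Fin 4 → ℂ := ![H1 m, H2 m, H3 m, K1 m]

/-- The expanded characteristic polynomial `R(x, ρ)`, as a function of the values
`κ = (H₀, K₀, J₁, J₂)` of the Casimirs and `h = (H₁, H₂, H₃, K₁)` of the Hamiltonians. -/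
def spectralFun (κ h : Fin 4 → ℂ) (x ρ : ℂ) : ℂ :=
  x ^ 4 - ρ + (-(κ 0 * x ^ 3) + h 0 * x ^ 2 - h 1 * x + h 2)
    + (κ 1 * x + h 3 - κ 2 * x ^ 2) / ρ + κ 3 / ρ ^ 2

/-- The coefficient `H(x)` of `ρ⁰` in `R(x, ρ) - x⁴`. -/
def polyH (x : ℂ) (m : Phase) : ℂ := -(x ^ 3 * H0 m) + x ^ 2 * H1 m - x * H2 m + H3 m

/-- The polynomial `K(x)`. -/
def polyK (x : ℂ) (m : Phase) : ℂ := x * K0 m + K1 m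

/-! ### The symplectic leaves of `P` -/

/-- The common level set `S_κ` of the Casimirs. -/
def leaf (κ : Fin 4 → ℂ) : Set Phase := {m | casimirs m = κ}

/-- The tangent space at `m` of the level set of the Casimirs through `m`. -/
def leafTangent (m : Phase) : Submodule ℂ Phase :=
  LinearMap.ker (fderiv ℂ casimirs m : Phase →ₗ[ℂ] (Fin 4 → ℂ))

/-- At `m`, the level set of the Casimirs is a regular one, and `P` induces on its tangent space a
nondegenerate bivector: the image of `P` is exactly the tangent space. -/
def IsSymplecticAt (m : Phase) : Prop :=
  Function.Surjective (fderiv ℂ casimirs m) ∧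
    Set.range (sharp (bivP m)) = (leafTangent m : Set Phase)

/-! ### The reduced second tensor -/

/-- The transversal vector fields `Z₁ = -∂/∂b₄` and `Z₂ = ∂/∂a₄`. -/
def Z : Fin 2 → Phase :=
  ![-Pi.single (Sum.inl 3) 1, Pi.single (Sum.inr (Sum.inl 3)) 1]

/-- The differentials of the two Casimirs `H₀`, `K₀` of `P` that are not Casimirs of `P'`. -/
def dF (m : Phase) : Fin 2 → (Phase →L[ℂ] ℂ) := ![fderiv ℂ H0 m, fderiv ℂ K0 m]

/-- The matrix `G` with entries `L_{Z_i} F_j`, where `F = (H₀, K₀)`. -/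
def redG (m : Phase) : Matrix (Fin 2) (Fin 2) ℂ := Matrix.of fun i j => dF m j (Z i)

/-- The bivector `Z ∧ X` with `(Z ∧ X) α = α(Z) X - α(X) Z`. -/
def wedge (Z X : Phase) : Matrix Idx Idx ℂ := Matrix.vecMulVec X Z - Matrix.vecMulVec Z X

/-- The bivector `Q = P' - Δ`, with `Δ = ∑ (G⁻¹)_{ji} Z_i ∧ P' dF_j`. -/
def bivQ (m : Phase) : Matrix Idx Idx ℂ :=
  bivP' m - ∑ i, ∑ j, (redG m)⁻¹ j i • wedge (Z i) (sharp (bivP' m) (dF m j))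

/-- `N` is the Nijenhuis operator `Q P⁻¹` on the tangent space of the leaf at `m`. -/
def IsNijenhuisOperator (m : Phase) (N : leafTangent m →ₗ[ℂ] leafTangent m) : Prop :=
  ∀ (α : Phase →L[ℂ] ℂ) (v : leafTangent m),
    sharp (bivP m) α = (v : Phase) → (N v : Phase) = sharp (bivQ m) α

/-! ### The coordinates `(λ_i, μ_i)` -/

/-- The matrix `𝒢(x)`: first row `L_{Z_j} H(x)`, second row `L_{Z_j} K(x)`. -/
def calG (m : Phase) (x : ℂ) : Matrix (Fin 2) (Fin 2) ℂ :=
  Matrix.of ![fun j => fderiv ℂ (polyH x) m (Z j), fun j => fderiv ℂ (polyK x) m (Z j)]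

/-- `ρ(x) = -𝒢₂₂(x) / 𝒢₁₂(x)`. -/
def rho (m : Phase) (x : ℂ) : ℂ := -calG m x 1 1 / calG m x 0 1

/-- On the open set `V`, the `λ_i` are holomorphic branches of the four distinct roots of `det 𝒢`,
and the `μ_i` are holomorphic branches of `log ρ(λ_i)`. -/
structure IsBranch (V : Set Phase) (lam mu : Fin 4 → Phase → ℂ) : Prop where
  isOpen : IsOpen V
  lam_holo : ∀ i, DifferentiableOn ℂ (lam i) V
  mu_holo : ∀ i, DifferentiableOn ℂ (mu i) V
  root : ∀ m ∈ V, ∀ i, (calG m (lam i m)).det = 0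
  distinct : ∀ m ∈ V, Function.Injective fun i => lam i m
  denom_ne : ∀ m ∈ V, ∀ i, calG m (lam i m) 0 1 ≠ 0
  exp_mu : ∀ m ∈ V, ∀ i, Complex.exp (mu i m) = rho m (lam i m)

/-- The points at which the construction makes sense: `G` is invertible (so that `Q` is defined and
`det 𝒢` has degree four), `det 𝒢` has four distinct roots, `ρ` is finite and nonzero at each of
them, and the eight functions `H₀, K₀, J₁, J₂, H₁, H₂, H₃, K₁` have independent differentials. -/
def regularSet : Set Phase :=
  {m | (redG m).det ≠ 0 ∧
    (∃ z : Fin 4 → ℂ, Function.Injective z ∧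
      ∀ i, (calG m (z i)).det = 0 ∧ calG m (z i) 0 1 ≠ 0 ∧ calG m (z i) 1 1 ≠ 0) ∧
    LinearIndependent ℂ
      (Sum.elim (fun i : Fin 4 => fderiv ℂ (fun x => casimirs x i) m)
        (fun i : Fin 4 => fderiv ℂ (fun x => hams x i) m))}

/-- `(λ, μ)` are Darboux-Nijenhuis coordinates at the point `m` of the leaf, for the pair of
bivectors induced by `P` and `Q`: their differentials form a basis of the cotangent space of the
leaf, they are canonical for `P`, and they diagonalize `N = Q P⁻¹` with eigenvalues `λ_i`. -/
structure IsDarbouxNijenhuisAt (lam mu : Fin 4 → Phase → ℂ) (m : Phase) : Prop where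
  basis : Function.Bijective fun v : leafTangent m =>
    (Sum.elim (fun i => fderiv ℂ (lam i) m v) (fun i => fderiv ℂ (mu i) m v) : Fin 4 ⊕ Fin 4 → ℂ)
  bracket_mu_lam : ∀ i j, bracket bivP (mu i) (lam j) m = if i = j then 1 else 0
  bracket_lam : ∀ i j, bracket bivP (lam i) (lam j) m = 0
  bracket_mu : ∀ i j, bracket bivP (mu i) (mu j) m = 0
  nijenhuis : ∃ N : leafTangent m →ₗ[ℂ] leafTangent m, IsNijenhuisOperator m N ∧
    ∀ (i : Fin 4) (v : leafTangent m),
      fderiv ℂ (lam i) m (N v) = lam i m * fderiv ℂ (lam i) m v ∧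
      fderiv ℂ (mu i) m (N v) = lam i m * fderiv ℂ (mu i) m v

/-! ### Integrability and separability -/

/-- On the leaf, near `m`, the Hamiltonians `H₁, H₂, H₃, K₁` are in involution and have independent
differentials at `m`. -/
def IsIntegrableAt (m : Phase) : Prop :=
  (∀ i j, bracket bivP (fun x => hams x i) (fun x => hams x j) m = 0) ∧
  LinearIndependent ℂ fun i : Fin 4 =>
    (fderiv ℂ (fun x => hams x i) m : Phase →ₗ[ℂ] ℂ).domRestrict (leafTangent m)

/-- On the subset `S`, the functions `Φ_i(x_i, y_i; h_1, …, h_4)` are separation relations for the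
Hamiltonians `h` in the coordinates `(x, y)`: they are holomorphic and vanish on `S`, each of them
depends effectively on its pair of coordinates, and they can be solved for the Hamiltonians. -/
structure IsSeparatedBy (S : Set Phase) (x y : Fin 4 → Phase → ℂ) (h : Phase → Fin 4 → ℂ)
    (Φ : Fin 4 → ℂ → ℂ → (Fin 4 → ℂ) → ℂ) : Prop where
  holo : ∀ i, Differentiable ℂ fun p : ℂ × ℂ × (Fin 4 → ℂ) => Φ i p.1 p.2.1 p.2.2
  relation : ∀ m ∈ S, ∀ i, Φ i (x i m) (y i m) (h m) = 0
  effective : ∀ m ∈ S, ∀ i,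
    deriv (fun s => Φ i s (y i m) (h m)) (x i m) ≠ 0 ∨
    deriv (fun s => Φ i (x i m) s (h m)) (y i m) ≠ 0
  solvable : ∀ m ∈ S,
    (Matrix.of fun i j : Fin 4 =>
      fderiv ℂ (Φ i (x i m) (y i m)) (h m) (Pi.single j 1)).det ≠ 0

end TodaFourThree

end

/-!
The flow `m ↦ m - x ∑ ∂/∂b_i` preserves `P` and carries `P'` to `P' - x P`. It pulls `H₃` and `K₁`,
which are Casimirs of `P'`, back to `H(x)` and `K(x)` up to functions of `x` and of the common
Casimir `J₁`; hence `dH(x)` and `dK(x)` lie in the kernel of `P' - x P`, and covectors in the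
kernels of two different members of the pencil are `P`-orthogonal. This gives the involution.

At a root `λ` of `det 𝒢` the row `(ρ, 1)` annihilates `𝒢(λ)`: the function `ρ H(λ) + K(λ)` has
vanishing derivatives along `Z₁` and `Z₂`. The gradients of these two derivatives, with `λ` and `ρ`
frozen, are eigen-covectors of the pencil modulo the span of `Z₁, Z₂`. The reduction of `P'` to `Q`
absorbs the error, so they satisfy `Q g = λ P g`, and differentiating the two relations implicitly
shows that they span the same plane as `dλ` and `dμ`. Eigen-covectors for different eigenvalues are
`P`-orthogonal, and for a common eigenvalue the pairing is computed by `(det 𝒢)'(λ)`.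

For the density statement, the conditions defining `U` follow from the nonvanishing of one
polynomial, which is nonzero at an explicit point. A regular leaf is swept out by entire curves
through points with given `c₁c₃` and `c₂c₄`, and an entire function of one variable that does not
vanish identically has isolated zeros. Multiplying the conditions at the two orderings of
`(c₁c₃, c₂c₄)`, which are determined by `J₁` and `J₂` up to order, makes them a polynomial in the
values of the Casimirs.
-/

noncomputable section

namespace TodaFourThree

/-! ### Skew forms, pencils and reduced bivectors -/

section SkewPencil

variable {ι R : Type*} [Fintype ι] [CommRing R] {A B : Matrix ι ι R} {g h : ι → R} {x y : R}

theorem dotProduct_mulVec_of_skew (hA : Aᵀ = -A) (g h : ι → R) :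
    g ⬝ᵥ A *ᵥ h = -(h ⬝ᵥ A *ᵥ g) := by
  rw [dotProduct_mulVec, ← mulVec_transpose, hA, neg_mulVec, neg_dotProduct, dotProduct_comm]

theorem dotProduct_mulVec_self_of_skew [IsAddTorsionFree R] (hA : Aᵀ = -A) (g : ι → R) :
    g ⬝ᵥ A *ᵥ g = 0 :=
  self_eq_neg.mp (dotProduct_mulVec_of_skew hA g g)

theorem dotProduct_mulVec_eq_zero_of_pencil [NoZeroDivisors R] (hA : Aᵀ = -A) (hB : Bᵀ = -B)
    (hxy : x ≠ y) (hg : B *ᵥ g = x • A *ᵥ g) (hh : B *ᵥ h = y • A *ᵥ h) : g ⬝ᵥ A *ᵥ h = 0 := by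
  have hpair : y * (g ⬝ᵥ A *ᵥ h) = x * (g ⬝ᵥ A *ᵥ h) :=
    calc y * (g ⬝ᵥ A *ᵥ h) = g ⬝ᵥ B *ᵥ h := by rw [hh, dotProduct_smul, smul_eq_mul]
      _ = -(h ⬝ᵥ B *ᵥ g) := dotProduct_mulVec_of_skew hB g h
      _ = x * (g ⬝ᵥ A *ᵥ h) := by
        rw [hg, dotProduct_smul, smul_eq_mul, dotProduct_mulVec_of_skew hA g h, mul_neg]
  exact (mul_eq_zero.mp (by linear_combination hpair : (y - x) * (g ⬝ᵥ A *ᵥ h) = 0)).resolve_left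
    (sub_ne_zero.mpr hxy.symm)

end SkewPencil

section Reduction

variable {ι κ K : Type*} [Fintype ι] [Fintype κ] [DecidableEq κ] [Field K]
  {A B : Matrix ι ι K} {z F : κ → ι → K} {g : ι → K} {x : K}

/-- The matrix of pairings `⟨z_i, F_j⟩` of transversal vectors with the differentials of the
functions that are reduced. -/
def pairing (z F : κ → ι → K) : Matrix κ κ K := of fun i j => F j ⬝ᵥ z i

/-- The bivector `B - ∑ (G⁻¹)_{ji} z_i ∧ B F_j`, where `G` is the matrix of pairings: the correction
of `B` along the transversal vectors `z_i` for which the `F_j` become Casimirs. -/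
def reducedBivector (B : Matrix ι ι K) (z F : κ → ι → K) : Matrix ι ι K :=
  B - ∑ i, ∑ j, (pairing z F)⁻¹ j i • (vecMulVec (B *ᵥ F j) (z i) - vecMulVec (z i) (B *ᵥ F j))

theorem reducedBivector_mulVec (B : Matrix ι ι K) (z F : κ → ι → K) (g : ι → K) :
    reducedBivector B z F *ᵥ g = B *ᵥ g - ∑ i, ∑ j, (pairing z F)⁻¹ j i •
      ((g ⬝ᵥ z i) • B *ᵥ F j - (B *ᵥ F j ⬝ᵥ g) • z i) := by
  simp only [reducedBivector, sub_mulVec, sum_mulVec, smul_mulVec, vecMulVec_mulVec,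
    op_smul_eq_smul, dotProduct_comm g]

theorem transpose_reducedBivector (hB : Bᵀ = -B) :
    (reducedBivector B z F)ᵀ = -reducedBivector B z F := by
  simp only [reducedBivector, transpose_sub, transpose_sum, transpose_smul, transpose_vecMulVec, hB]
  simp only [sub_eq_add_neg, neg_add, ← Finset.sum_neg_distrib, ← smul_neg, neg_neg,
    add_comm]

theorem reducedBivector_mulVec_casimir (hG : IsUnit (pairing z F).det) {k : κ}
    (hF : ∀ j, F k ⬝ᵥ B *ᵥ F j = 0) : reducedBivector B z F *ᵥ F k = 0 := by
  have hinv : ∀ j, ∑ i, (pairing z F)⁻¹ j i * (F k ⬝ᵥ z i) = (1 : Matrix κ κ K) j k := fun j =>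
    congrFun (congrFun (nonsing_inv_mul (pairing z F) hG) j) k
  simp only [reducedBivector_mulVec, dotProduct_comm _ (F k), hF, zero_smul, sub_zero, smul_smul]
  rw [Finset.sum_comm]
  simp only [← Finset.sum_smul, hinv, one_apply, ite_smul, one_smul, zero_smul,
    Finset.sum_ite_eq', Finset.mem_univ, if_true, sub_self]

theorem reducedBivector_mulVec_eq_smul (hA : Aᵀ = -A) (hB : Bᵀ = -B)
    (hG : IsUnit (pairing z F).det) (hF : ∀ j k, F k ⬝ᵥ B *ᵥ F j = 0) (hAF : ∀ j, A *ᵥ F j = 0)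
    (hg : ∀ i, g ⬝ᵥ z i = 0) {a : κ → K} (hBg : B *ᵥ g = x • A *ᵥ g + ∑ i, a i • z i) :
    reducedBivector B z F *ᵥ g = x • A *ᵥ g := by
  set Q := reducedBivector B z F
  set d : κ → K := fun i => a i + ∑ j, (pairing z F)⁻¹ j i * (B *ᵥ F j ⬝ᵥ g)
  have hQg : Q *ᵥ g = x • A *ᵥ g + ∑ i, d i • z i := by
    simp only [Q, d, reducedBivector_mulVec, hg, hBg, zero_smul, zero_sub, smul_neg, smul_smul,
      Finset.sum_neg_distrib, sub_neg_eq_add, ← Finset.sum_smul, add_smul, Finset.sum_add_distrib,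
      add_assoc]
  -- Pairing with `F k` annihilates `Q *ᵥ g` and `A *ᵥ g`, hence also their transversal difference.
  have hd : d ᵥ* pairing z F = 0 := by
    ext k
    have h := congrArg (F k ⬝ᵥ ·) hQg
    simp only [dotProduct_mulVec_of_skew (transpose_reducedBivector hB) (F k) g, Q,
      reducedBivector_mulVec_casimir hG fun j => hF j k, dotProduct_add, dotProduct_smul,
      dotProduct_mulVec_of_skew hA (F k) g, hAF, dotProduct_zero, neg_zero, smul_zero, zero_add,
      dotProduct_sum] at h
    exact h.symm
  have hd0 : d = 0 := eq_zero_of_vecMul_eq_zero hG.ne_zero hd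
  simpa only [hd0, Pi.zero_apply, zero_smul, Finset.sum_const_zero, add_zero] using hQg

end Reduction

section Combination

variable {ι K V : Type*} [Fintype ι] [Field K] [AddCommGroup V] [Module K V]
  {p₀ q₀ p₁ q₁ : K}

theorem mem_and_mem_of_combinations (hd : p₀ * q₁ - p₁ * q₀ ≠ 0) {W : Submodule K V} {l u : V}
    (h₀ : p₀ • l + q₀ • u ∈ W) (h₁ : p₁ • l + q₁ • u ∈ W) : l ∈ W ∧ u ∈ W := by
  constructor
  · refine (W.smul_mem_iff hd).mp ?_
    convert W.sub_mem (W.smul_mem q₁ h₀) (W.smul_mem q₀ h₁) using 1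
    module
  · refine (W.smul_mem_iff hd).mp ?_
    convert W.sub_mem (W.smul_mem p₀ h₁) (W.smul_mem p₁ h₀) using 1
    module

theorem dotProduct_mulVec_combinations [IsAddTorsionFree K] {A : Matrix ι ι K} (hA : Aᵀ = -A)
    (l u : ι → K) : (p₀ • l + q₀ • u) ⬝ᵥ A *ᵥ (p₁ • l + q₁ • u)
      = -(p₀ * q₁ - p₁ * q₀) * (u ⬝ᵥ A *ᵥ l) := by
  simp only [add_dotProduct, smul_dotProduct, mulVec_add, mulVec_smul, dotProduct_add,
    dotProduct_smul, smul_eq_mul, dotProduct_mulVec_self_of_skew hA,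
    dotProduct_mulVec_of_skew hA l u]
  ring

end Combination

theorem exists_dotProduct_eq_of_linearIndependent {ι κ K : Type*} [Fintype ι] [Finite κ] [Field K]
    {g : κ → ι → K} (hg : LinearIndependent K g) (w : κ → K) : ∃ v, ∀ i, g i ⬝ᵥ v = w i := by
  have := Fintype.ofFinite κ
  have htop : LinearMap.range (of g).mulVecLin = ⊤ := by
    refine Submodule.eq_top_of_finrank_eq ?_
    rw [Module.finrank_fintype_fun_eq_card]
    exact LinearIndependent.rank_matrix (M := of g) hg
  obtain ⟨v, hv⟩ := LinearMap.range_eq_top.mp htop w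
  exact ⟨v, congrFun hv⟩

/-! ### Covectors and gradients on the phase space -/

/-- The vector, or covector, whose `b`-, `a`- and `c`-components are the three arguments. -/
def vec (b a c : Fin 4 → ℂ) : Phase := Sum.elim b (Sum.elim a c)

theorem bc_vec (b a c : Fin 4 → ℂ) : bc (vec b a c) = b := rfl

theorem ac_vec (b a c : Fin 4 → ℂ) : ac (vec b a c) = a := rfl

theorem cc_vec (b a c : Fin 4 → ℂ) : cc (vec b a c) = c := rfl

theorem phase_ext {v w : Phase} (hb : ∀ i, bc v i = bc w i) (ha : ∀ i, ac v i = ac w i)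
    (hc : ∀ i, cc v i = cc w i) : v = w := by
  ext s
  rcases s with i | i | i
  exacts [hb i, ha i, hc i]

theorem vec_eq_zero {b a c : Fin 4 → ℂ} (hb : ∀ i, b i = 0) (ha : ∀ i, a i = 0)
    (hc : ∀ i, c i = 0) : vec b a c = 0 :=
  phase_ext hb ha hc

theorem vec_sub_smul_vec (x : ℂ) (b a c b' a' c' : Fin 4 → ℂ) : vec b a c - x • vec b' a' c' =
    vec (fun i => b i - x * b' i) (fun i => a i - x * a' i) (fun i => c i - x * c' i) :=
  phase_ext (fun _ => rfl) (fun _ => rfl) fun _ => rfl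

theorem dotProduct_phase (g v : Phase) : g ⬝ᵥ v =
    ∑ i, bc g i * bc v i + (∑ i, ac g i * ac v i + ∑ i, cc g i * cc v i) := by
  simp only [dotProduct, Fintype.sum_sum_type]
  rfl

/-- The continuous linear functional with a given vector of components. -/
def covec : Phase ≃ₗ[ℂ] (Phase →L[ℂ] ℂ) :=
  (dotProductEquiv ℂ Idx).trans LinearMap.toContinuousLinearMap

theorem covec_apply (g v : Phase) : covec g v = g ⬝ᵥ v := rfl

theorem sharp_covec (B : Matrix Idx Idx ℂ) (g : Phase) : sharp B (covec g) = B *ᵥ g := by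
  simp only [sharp, covec_apply, dotProduct_single_one]

/-- The vector of partial derivatives of `f` at `m`. -/
def grad (f : Phase → ℂ) (m : Phase) : Phase := covec.symm (fderiv ℂ f m)

theorem covec_grad (f : Phase → ℂ) (m : Phase) : covec (grad f m) = fderiv ℂ f m :=
  covec.apply_symm_apply _

theorem fderiv_apply (f : Phase → ℂ) (m v : Phase) : fderiv ℂ f m v = grad f m ⬝ᵥ v := by
  rw [← covec_grad, covec_apply]

theorem grad_eq {f : Phase → ℂ} {m g : Phase} (h : ∀ v, fderiv ℂ f m v = g ⬝ᵥ v) :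
    grad f m = g :=
  covec.symm_apply_eq.mpr (ContinuousLinearMap.ext h)

theorem sharp_fderiv (B : Matrix Idx Idx ℂ) (f : Phase → ℂ) (m : Phase) :
    sharp B (fderiv ℂ f m) = B *ᵥ grad f m := by
  rw [← covec_grad, sharp_covec]

theorem bracket_eq (B : Phase → Matrix Idx Idx ℂ) (f g : Phase → ℂ) (m : Phase) :
    bracket B f g m = grad f m ⬝ᵥ B m *ᵥ grad g m := by
  rw [bracket, sharp_fderiv, fderiv_apply]

theorem fderiv_coord (m v : Phase) (s : Idx) : fderiv ℂ (fun p : Phase => p s) m v = v s :=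
  DFunLike.congr_fun (ContinuousLinearMap.proj (R := ℂ) (φ := fun _ : Idx => ℂ) s).fderiv v

theorem fderiv_bc (m v : Phase) (i : Fin 4) : fderiv ℂ (fun p => bc p i) m v = bc v i :=
  fderiv_coord m v _

theorem fderiv_ac (m v : Phase) (i : Fin 4) : fderiv ℂ (fun p => ac p i) m v = ac v i :=
  fderiv_coord m v _

theorem fderiv_cc (m v : Phase) (i : Fin 4) : fderiv ℂ (fun p => cc p i) m v = cc v i :=
  fderiv_coord m v _

@[fun_prop]
theorem differentiable_bc (i : Fin 4) : Differentiable ℂ fun m => bc m i :=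
  differentiable_apply _

@[fun_prop]
theorem differentiable_ac (i : Fin 4) : Differentiable ℂ fun m => ac m i :=
  differentiable_apply _

@[fun_prop]
theorem differentiable_cc (i : Fin 4) : Differentiable ℂ fun m => cc m i :=
  differentiable_apply _

@[fun_prop]
theorem differentiable_H0 : Differentiable ℂ H0 := by unfold H0; fun_prop

@[fun_prop]
theorem differentiable_H1 : Differentiable ℂ H1 := by unfold H1; fun_prop

@[fun_prop]
theorem differentiable_H2 : Differentiable ℂ H2 := by unfold H2; fun_prop

@[fun_prop]
theorem differentiable_H3 : Differentiable ℂ H3 := by unfold H3; fun_prop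

@[fun_prop]
theorem differentiable_K0 : Differentiable ℂ K0 := by unfold K0; fun_prop

@[fun_prop]
theorem differentiable_K1 : Differentiable ℂ K1 := by unfold K1; fun_prop

@[fun_prop]
theorem differentiable_J1 : Differentiable ℂ J1 := by unfold J1; fun_prop

@[fun_prop]
theorem differentiable_J2 : Differentiable ℂ J2 := by unfold J2; fun_prop

theorem grad_H0 (m : Phase) : grad H0 m = vec 1 0 0 := by
  refine grad_eq fun v => ?_
  unfold H0
  simp (disch := fun_prop) only [Fin.sum_univ_four, Fin.isValue, fderiv_fun_add,
    _root_.add_apply, fderiv_bc, dotProduct_phase, bc_vec, ac_vec, cc_vec, Pi.one_apply,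
    Pi.zero_apply]
  ring

theorem grad_H1 (m : Phase) : grad H1 m =
    vec (fun i => bc m (i + 1) + bc m (i + 2) + bc m (i + 3)) 1 0 := by
  refine grad_eq fun v => ?_
  unfold H1
  simp (disch := fun_prop) only [Fin.sum_univ_four, Fin.isValue, Fin.reduceAdd, fderiv_fun_add,
    fderiv_fun_mul, _root_.add_apply, _root_.smul_apply, smul_eq_mul, fderiv_bc, fderiv_ac,
    dotProduct_phase, bc_vec, ac_vec, cc_vec, Pi.one_apply, Pi.zero_apply]
  ring

theorem grad_H2 (m : Phase) : grad H2 m =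
    vec (fun i => bc m (i + 1) * bc m (i + 2) + bc m (i + 1) * bc m (i + 3)
        + bc m (i + 2) * bc m (i + 3) + ac m (i + 1) + ac m (i + 2))
      (fun i => bc m (i + 2) + bc m (i + 3)) 1 := by
  refine grad_eq fun v => ?_
  unfold H2
  simp (disch := fun_prop) only [Fin.sum_univ_four, Fin.isValue, Fin.reduceAdd, fderiv_fun_add,
    fderiv_fun_mul, _root_.add_apply, _root_.smul_apply, smul_eq_mul, fderiv_bc, fderiv_ac,
    fderiv_cc, dotProduct_phase, bc_vec, ac_vec, cc_vec, Pi.one_apply]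
  ring

theorem grad_H3 (m : Phase) : grad H3 m =
    vec (fun i => bc m (i + 1) * bc m (i + 2) * bc m (i + 3) + bc m (i + 1) * ac m (i + 2)
        + bc m (i + 3) * ac m (i + 1) + cc m (i + 1))
      (fun i => bc m (i + 2) * bc m (i + 3) + ac m (i + 2)) (fun i => bc m (i + 3)) := by
  refine grad_eq fun v => ?_
  unfold H3
  simp (disch := fun_prop) only [Fin.sum_univ_four, Fin.isValue, Fin.reduceAdd, fderiv_fun_add,
    fderiv_fun_mul, _root_.add_apply, _root_.smul_apply, smul_eq_mul, fderiv_bc, fderiv_ac,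
    fderiv_cc, dotProduct_phase, bc_vec, ac_vec, cc_vec]
  ring

theorem grad_K0 (m : Phase) : grad K0 m =
    vec (fun i => cc m (i + 1) * cc m (i + 3))
      (fun i => -(ac m (i + 1) * cc m (i + 2)) - ac m (i + 3) * cc m (i + 1))
      (fun i => (bc m (i + 1) + bc m (i + 3)) * cc m (i + 2) - ac m (i + 2) * ac m (i + 3)) := by
  refine grad_eq fun v => ?_
  unfold K0
  simp (disch := fun_prop) only [Fin.sum_univ_four, Fin.isValue, Fin.reduceAdd, fderiv_fun_add,
    fderiv_fun_sub, fderiv_fun_mul, _root_.add_apply, _root_.sub_apply, _root_.smul_apply,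
    smul_eq_mul, fderiv_bc, fderiv_ac, fderiv_cc, dotProduct_phase, bc_vec, ac_vec, cc_vec]
  ring

theorem grad_K1 (m : Phase) : grad K1 m =
    vec (fun i => ac m (i + 1) * ac m (i + 2) * cc m (i + 3)
        - bc m (i + 2) * cc m (i + 1) * cc m (i + 3))
      (fun i => bc m (i + 2) * ac m (i + 3) * cc m (i + 1)
        + bc m (i + 3) * ac m (i + 1) * cc m (i + 2)
        - ac m (i + 1) * ac m (i + 2) * ac m (i + 3) + cc m (i + 1) * cc m (i + 2))
      (fun i => bc m (i + 1) * ac m (i + 2) * ac m (i + 3)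
        - bc m (i + 1) * bc m (i + 3) * cc m (i + 2)
        + ac m (i + 2) * cc m (i + 3) + ac m (i + 3) * cc m (i + 1)) := by
  refine grad_eq fun v => ?_
  unfold K1
  simp (disch := fun_prop) only [Fin.sum_univ_four, Fin.isValue, Fin.reduceAdd, fderiv_fun_add,
    fderiv_fun_sub, fderiv_fun_mul, _root_.add_apply, _root_.sub_apply, _root_.smul_apply,
    smul_eq_mul, fderiv_bc, fderiv_ac, fderiv_cc, dotProduct_phase, bc_vec, ac_vec, cc_vec]
  ring

theorem grad_J1 (m : Phase) : grad J1 m = vec 0 0 (fun i => cc m (i + 2)) := by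
  refine grad_eq fun v => ?_
  unfold J1
  simp (disch := fun_prop) only [Fin.sum_univ_four, Fin.isValue, Fin.reduceAdd, fderiv_fun_add,
    fderiv_fun_mul, _root_.add_apply, _root_.smul_apply, smul_eq_mul, fderiv_cc, dotProduct_phase,
    bc_vec, ac_vec, cc_vec, Pi.zero_apply]
  ring

theorem grad_J2 (m : Phase) : grad J2 m =
    vec 0 0 (fun i => cc m (i + 1) * cc m (i + 2) * cc m (i + 3)) := by
  refine grad_eq fun v => ?_
  unfold J2
  simp (disch := fun_prop) only [Fin.sum_univ_four, Fin.isValue, Fin.reduceAdd, fderiv_fun_mul,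
    _root_.add_apply, _root_.smul_apply, smul_eq_mul, fderiv_cc, dotProduct_phase, bc_vec, ac_vec,
    cc_vec, Pi.zero_apply]
  ring

theorem bivP_mulVec (m v : Phase) : bivP m *ᵥ v = vec
    (fun i => ac m (i + 3) * ac v (i + 3) - ac m i * ac v i
      + cc m (i + 2) * cc v (i + 2) - cc m i * cc v i)
    (fun i => ac m i * (bc v i - bc v (i + 1))
      + cc m (i + 3) * ac v (i + 3) - cc m i * ac v (i + 1))
    (fun i => cc m i * (bc v i - bc v (i + 2))) := by
  ext s
  rcases s with i | i | i <;> fin_cases i <;>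
    simp [bivP, blockA1, blockC1, blockC2, mulVec, dotProduct, Fintype.sum_sum_type,
      Fin.sum_univ_four, vec, bc, ac, cc] <;> ring

theorem bivP'_mulVec (m v : Phase) : bivP' m *ᵥ v = vec
    (fun i => ac m i * bc v (i + 1) - ac m (i + 3) * bc v (i + 3)
      + bc m i * (ac m (i + 3) * ac v (i + 3) - ac m i * ac v i)
      + cc m i * ac v (i + 1) - cc m (i + 2) * ac v (i + 2)
      + bc m i * (cc m (i + 2) * cc v (i + 2) - cc m i * cc v i))
    (fun i => ac m i * (bc m i * bc v i - bc m (i + 1) * bc v (i + 1))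
      + cc m i * bc v (i + 2) - cc m (i + 3) * bc v (i + 3)
      + (bc m i * cc m (i + 3) + ac m i * ac m (i + 3)) * ac v (i + 3)
      - (bc m (i + 1) * cc m i + ac m i * ac m (i + 1)) * ac v (i + 1)
      + ac m i * (cc m (i + 2) * cc v (i + 2) + cc m (i + 3) * cc v (i + 3)
        - cc m i * cc v i - cc m (i + 1) * cc v (i + 1)))
    (fun i => cc m i * (bc m i * bc v i - bc m (i + 2) * bc v (i + 2)
      + ac m i * ac v i + ac m (i + 3) * ac v (i + 3)
      - ac m (i + 1) * ac v (i + 1) - ac m (i + 2) * ac v (i + 2)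
      + cc m (i + 3) * cc v (i + 3) - cc m (i + 1) * cc v (i + 1))) := by
  ext s
  rcases s with i | i | i <;> fin_cases i <;>
    simp [bivP', blockA2, blockB1, blockC3, blockA3, blockC4, blockA4, mulVec, dotProduct,
      Fintype.sum_sum_type, Fin.sum_univ_four, vec, bc, ac, cc] <;> ring

theorem transpose_bivP (m : Phase) : (bivP m)ᵀ = -bivP m := by
  have hC2 : (blockC2 (cc m))ᵀ = -blockC2 (cc m) := by
    ext i j; fin_cases i <;> fin_cases j <;> simp [blockC2]
  simp [bivP, fromBlocks_transpose, fromBlocks_neg, transpose_fromCols, transpose_fromRows,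
    fromRows_neg, fromCols_neg, hC2]

theorem transpose_bivP' (m : Phase) : (bivP' m)ᵀ = -bivP' m := by
  have hA2 : (blockA2 (ac m))ᵀ = -blockA2 (ac m) := by
    ext i j; fin_cases i <;> fin_cases j <;> simp [blockA2]
  have hA3 : (blockA3 (bc m) (ac m) (cc m))ᵀ = -blockA3 (bc m) (ac m) (cc m) := by
    ext i j; fin_cases i <;> fin_cases j <;> simp [blockA3] <;> ring
  have hA4 : (blockA4 (cc m))ᵀ = -blockA4 (cc m) := by
    ext i j; fin_cases i <;> fin_cases j <;> simp [blockA4]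
  simp [bivP', fromBlocks_transpose, fromBlocks_neg, transpose_fromCols, transpose_fromRows,
    fromRows_neg, fromCols_neg, hA2, hA3, hA4]

/-! ### The pencil of the two tensors and the shift flow -/

theorem bivP_mulVec_grad_H0 (m : Phase) : bivP m *ᵥ grad H0 m = 0 := by
  rw [bivP_mulVec, grad_H0]
  refine vec_eq_zero (fun i => ?_) (fun i => ?_) fun i => ?_ <;>
    simp only [bc_vec, ac_vec, cc_vec, Pi.one_apply, Pi.zero_apply] <;>
    ring

theorem bivP_mulVec_grad_K0 (m : Phase) : bivP m *ᵥ grad K0 m = 0 := by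
  rw [bivP_mulVec, grad_K0]
  refine vec_eq_zero (fun i => ?_) (fun i => ?_) fun i => ?_ <;>
    simp only [bc_vec, ac_vec, cc_vec, add_assoc, Fin.reduceAdd, Fin.isValue, add_zero] <;>
    ring

theorem bivP_mulVec_grad_J1 (m : Phase) : bivP m *ᵥ grad J1 m = 0 := by
  rw [bivP_mulVec, grad_J1]
  refine vec_eq_zero (fun i => ?_) (fun i => ?_) fun i => ?_ <;>
    simp only [bc_vec, ac_vec, cc_vec, add_assoc, Fin.reduceAdd, Fin.isValue, add_zero,
      Pi.zero_apply] <;>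
    ring

theorem bivP_mulVec_grad_J2 (m : Phase) : bivP m *ᵥ grad J2 m = 0 := by
  rw [bivP_mulVec, grad_J2]
  refine vec_eq_zero (fun i => ?_) (fun i => ?_) fun i => ?_ <;>
    simp only [bc_vec, ac_vec, cc_vec, add_assoc, Fin.reduceAdd, Fin.isValue, add_zero,
      Pi.zero_apply] <;>
    ring

theorem bivP'_mulVec_grad_J1 (m : Phase) : bivP' m *ᵥ grad J1 m = 0 := by
  rw [bivP'_mulVec, grad_J1]
  refine vec_eq_zero (fun i => ?_) (fun i => ?_) fun i => ?_ <;>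
    simp only [bc_vec, ac_vec, cc_vec, add_assoc, Fin.reduceAdd, Fin.isValue, add_zero,
      Pi.zero_apply] <;>
    ring

theorem bivP'_mulVec_grad_J2 (m : Phase) : bivP' m *ᵥ grad J2 m = 0 := by
  rw [bivP'_mulVec, grad_J2]
  refine vec_eq_zero (fun i => ?_) (fun i => ?_) fun i => ?_ <;>
    simp only [bc_vec, ac_vec, cc_vec, add_assoc, Fin.reduceAdd, Fin.isValue, add_zero,
      Pi.zero_apply] <;>
    ring

theorem bivP'_mulVec_grad_H3 (m : Phase) : bivP' m *ᵥ grad H3 m = 0 := by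
  rw [bivP'_mulVec, grad_H3]
  refine vec_eq_zero (fun i => ?_) (fun i => ?_) fun i => ?_ <;>
    simp only [bc_vec, ac_vec, cc_vec, add_assoc, Fin.reduceAdd, Fin.isValue, add_zero] <;>
    ring

theorem bivP'_mulVec_grad_K1 (m : Phase) : bivP' m *ᵥ grad K1 m = 0 := by
  rw [bivP'_mulVec, grad_K1]
  refine vec_eq_zero (fun i => ?_) (fun i => ?_) fun i => ?_ <;>
    simp only [bc_vec, ac_vec, cc_vec, add_assoc, Fin.reduceAdd, Fin.isValue, add_zero] <;>
    ring

theorem grad_K0_dotProduct_bivP'_grad_H0 (m : Phase) :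
    grad K0 m ⬝ᵥ bivP' m *ᵥ grad H0 m = 0 := by
  rw [bivP'_mulVec, grad_H0, grad_K0, dotProduct_phase]
  simp only [bc_vec, ac_vec, cc_vec, Fin.sum_univ_four, Fin.reduceAdd, Fin.isValue,
    Pi.one_apply, Pi.zero_apply]
  ring

/-- The flow of `-∑ ∂/∂b_i`. It preserves `P` and moves `P'` inside the pencil of `P` and `P'`. -/
def shift (x : ℂ) (m : Phase) : Phase := m - x • vec 1 0 0

theorem bc_shift (x : ℂ) (m : Phase) (i : Fin 4) : bc (shift x m) i = bc m i - x :=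
  congrArg (bc m i - ·) (mul_one x)

theorem ac_shift (x : ℂ) (m : Phase) : ac (shift x m) = ac m :=
  funext fun i => (congrArg (ac m i - ·) (mul_zero x)).trans (sub_zero _)

theorem cc_shift (x : ℂ) (m : Phase) : cc (shift x m) = cc m :=
  funext fun i => (congrArg (cc m i - ·) (mul_zero x)).trans (sub_zero _)

theorem grad_comp_shift (f : Phase → ℂ) (x : ℂ) (m : Phase) :
    grad (fun p => f (shift x p)) m = grad f (shift x m) :=
  congrArg covec.symm (fderiv_comp_sub _)

theorem bivP_shift (x : ℂ) (m : Phase) : bivP (shift x m) = bivP m := by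
  simp only [bivP, ac_shift, cc_shift]

theorem bivP'_shift_mulVec (x : ℂ) (m v : Phase) :
    bivP' (shift x m) *ᵥ v = bivP' m *ᵥ v - x • bivP m *ᵥ v := by
  rw [bivP'_mulVec, bivP'_mulVec, bivP_mulVec, vec_sub_smul_vec]
  refine phase_ext (fun i => ?_) (fun i => ?_) fun i => ?_ <;>
    simp only [bc_vec, ac_vec, cc_vec, bc_shift, ac_shift, cc_shift] <;>
    ring

theorem polyH_eq (x : ℂ) (m : Phase) : polyH x m = H3 (shift x m) - x ^ 4 := by
  simp only [polyH, H0, H1, H2, H3, bc_shift, ac_shift, cc_shift, Fin.sum_univ_four, Fin.isValue,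
    Fin.reduceAdd]
  ring

theorem polyK_eq (x : ℂ) (m : Phase) : polyK x m = K1 (shift x m) + x ^ 2 * J1 m := by
  simp only [polyK, K0, K1, J1, bc_shift, ac_shift, cc_shift, Fin.sum_univ_four, Fin.isValue,
    Fin.reduceAdd]
  ring

theorem grad_polyH (x : ℂ) (m : Phase) : grad (polyH x) m = grad H3 (shift x m) := by
  rw [funext (polyH_eq x), ← grad_comp_shift]
  exact congrArg covec.symm (fderiv_sub_const _)

theorem differentiable_comp_shift {f : Phase → ℂ} (hf : Differentiable ℂ f) (x : ℂ) :
    Differentiable ℂ fun m => f (shift x m) :=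
  hf.comp (differentiable_id.sub_const _)

theorem grad_polyK (x : ℂ) (m : Phase) :
    grad (polyK x) m = grad K1 (shift x m) + x ^ 2 • grad J1 m := by
  rw [funext (polyK_eq x), ← grad_comp_shift]
  refine grad_eq fun v => ?_
  have hK := differentiable_comp_shift differentiable_K1 x
  rw [fderiv_fun_add (hK m) (by fun_prop), fderiv_const_mul (differentiable_J1 m)]
  simp only [_root_.add_apply, _root_.smul_apply, fderiv_apply, add_dotProduct, smul_dotProduct]

theorem bivP'_mulVec_grad_polyH (x : ℂ) (m : Phase) :
    bivP' m *ᵥ grad (polyH x) m = x • bivP m *ᵥ grad (polyH x) m := by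
  rw [← sub_eq_zero, ← bivP'_shift_mulVec, grad_polyH, bivP'_mulVec_grad_H3]

theorem bivP'_mulVec_grad_polyK (x : ℂ) (m : Phase) :
    bivP' m *ᵥ grad (polyK x) m = x • bivP m *ᵥ grad (polyK x) m := by
  rw [grad_polyK, mulVec_add, mulVec_add, mulVec_smul, mulVec_smul, bivP'_mulVec_grad_J1,
    bivP_mulVec_grad_J1, smul_zero, add_zero, add_zero, ← sub_eq_zero, ← bivP'_shift_mulVec,
    bivP'_mulVec_grad_K1]

theorem grad_polyH_eq (x : ℂ) (m : Phase) : grad (polyH x) m =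
    -(x ^ 3 • grad H0 m) + x ^ 2 • grad H1 m - x • grad H2 m + grad H3 m := by
  refine grad_eq fun v => ?_
  unfold polyH
  simp (disch := fun_prop) only [fderiv_fun_add, fderiv_fun_sub, fderiv_fun_neg,
    fderiv_const_mul, _root_.add_apply, _root_.sub_apply, _root_.neg_apply, _root_.smul_apply,
    fderiv_apply, add_dotProduct, sub_dotProduct, neg_dotProduct, smul_dotProduct]

theorem grad_polyK_eq (x : ℂ) (m : Phase) : grad (polyK x) m = x • grad K0 m + grad K1 m := by
  refine grad_eq fun v => ?_
  unfold polyK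
  simp (disch := fun_prop) only [fderiv_fun_add, fderiv_const_mul, _root_.add_apply,
    _root_.smul_apply, fderiv_apply, add_dotProduct, smul_dotProduct]

theorem grad_polyH_dotProduct_grad_polyH {x y : ℂ} (hxy : x ≠ y) (m : Phase) :
    grad (polyH x) m ⬝ᵥ bivP m *ᵥ grad (polyH y) m = 0 :=
  dotProduct_mulVec_eq_zero_of_pencil (transpose_bivP m) (transpose_bivP' m) hxy
    (bivP'_mulVec_grad_polyH x m) (bivP'_mulVec_grad_polyH y m)

theorem grad_polyH_dotProduct_grad_K1 (x : ℂ) (m : Phase) :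
    grad (polyH x) m ⬝ᵥ bivP m *ᵥ grad K1 m = 0 := by
  have h := dotProduct_mulVec_eq_zero_of_pencil (transpose_bivP m) (transpose_bivP' m)
    (by simp : x ≠ x + 1) (bivP'_mulVec_grad_polyH x m) (bivP'_mulVec_grad_polyK (x + 1) m)
  simpa only [grad_polyK_eq, mulVec_add, mulVec_smul, bivP_mulVec_grad_K0, smul_zero, zero_add]
    using h

/-! ### The matrix `𝒢` and the relations defining `(λ, ρ)` -/

theorem Z_zero : Z 0 = vec (-Pi.single 3 1) 0 0 := by
  ext s; rcases s with i | i | i <;> simp [Z, vec, Pi.single_apply]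

theorem Z_one : Z 1 = vec 0 (Pi.single 3 1) 0 := by
  ext s; rcases s with i | i | i <;> simp [Z, vec, Pi.single_apply]

theorem dotProduct_Z_zero (g : Phase) : g ⬝ᵥ Z 0 = -bc g 3 := by
  simp [Z_zero, dotProduct_phase, bc_vec, ac_vec, cc_vec, Pi.single_apply]

theorem dotProduct_Z_one (g : Phase) : g ⬝ᵥ Z 1 = ac g 3 := by
  simp [Z_one, dotProduct_phase, bc_vec, ac_vec, cc_vec, Pi.single_apply]

theorem exists_eq_sum_smul_Z {v : Phase} (hb : ∀ i ≠ 3, bc v i = 0) (ha : ∀ i ≠ 3, ac v i = 0)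
    (hc : ∀ i, cc v i = 0) : ∃ a : Fin 2 → ℂ, v = ∑ i, a i • Z i := by
  refine ⟨![-bc v 3, ac v 3], ?_⟩
  rw [Fin.sum_univ_two, Z_zero, Z_one]
  refine phase_ext (fun i => ?_) (fun i => ?_) fun i => ?_
  · rcases eq_or_ne i 3 with rfl | hi
    · simp [bc, vec]
    · simpa [bc, vec, hi] using hb i hi
  · rcases eq_or_ne i 3 with rfl | hi
    · simp [ac, vec]
    · simpa [ac, vec, hi] using ha i hi
  · simpa [cc, vec] using hc i

/-- The Lie derivative of `f` along `Z_j`. -/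
def lieZ (f : Phase → ℂ) (j : Fin 2) (m : Phase) : ℂ := fderiv ℂ f m (Z j)

theorem lieZ_zero (f : Phase → ℂ) (m : Phase) : lieZ f 0 m = -bc (grad f m) 3 := by
  rw [lieZ, fderiv_apply, dotProduct_Z_zero]

theorem lieZ_one (f : Phase → ℂ) (m : Phase) : lieZ f 1 m = ac (grad f m) 3 := by
  rw [lieZ, fderiv_apply, dotProduct_Z_one]

theorem lieZ_H3_zero (m : Phase) : lieZ H3 0 m =
    -(bc m 0 * bc m 1 * bc m 2 + bc m 0 * ac m 1 + bc m 2 * ac m 0 + cc m 0) := by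
  rw [lieZ_zero, grad_H3]
  rfl

theorem lieZ_H3_one (m : Phase) : lieZ H3 1 m = bc m 1 * bc m 2 + ac m 1 := by
  rw [lieZ_one, grad_H3]
  rfl

theorem lieZ_K1_zero (m : Phase) :
    lieZ K1 0 m = bc m 1 * cc m 0 * cc m 2 - ac m 0 * ac m 1 * cc m 2 := by
  rw [lieZ_zero, grad_K1]
  simp only [bc_vec, Fin.isValue, Fin.reduceAdd]
  ring

theorem lieZ_K1_one (m : Phase) : lieZ K1 1 m = bc m 1 * ac m 2 * cc m 0
    + bc m 2 * ac m 0 * cc m 1 - ac m 0 * ac m 1 * ac m 2 + cc m 0 * cc m 1 := by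
  rw [lieZ_one, grad_K1]
  rfl

theorem calG_apply_zero (m : Phase) (x : ℂ) (j : Fin 2) :
    calG m x 0 j = lieZ H3 j (shift x m) := by
  change fderiv ℂ (polyH x) m (Z j) = _
  rw [fderiv_apply, grad_polyH, ← fderiv_apply, lieZ]

theorem calG_apply_one (m : Phase) (x : ℂ) (j : Fin 2) :
    calG m x 1 j = lieZ K1 j (shift x m) := by
  have hJ : grad J1 m ⬝ᵥ Z j = 0 := by
    rw [grad_J1]; fin_cases j
    exacts [(dotProduct_Z_zero _).trans neg_zero, dotProduct_Z_one _]
  change fderiv ℂ (polyK x) m (Z j) = _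
  rw [fderiv_apply, grad_polyK, add_dotProduct, smul_dotProduct, hJ, smul_zero, add_zero,
    ← fderiv_apply, lieZ]

theorem det_redG (m : Phase) :
    (redG m).det = ac m 0 * cc m 1 + ac m 2 * cc m 0 := by
  rw [det_fin_two]
  change lieZ H0 0 m * lieZ K0 1 m - lieZ K0 0 m * lieZ H0 1 m = _
  rw [lieZ_zero H0, lieZ_one H0, lieZ_one K0, grad_H0, grad_K0]
  simp only [bc_vec, ac_vec, Fin.isValue, Fin.reduceAdd, Pi.one_apply, Pi.zero_apply]
  ring

/-- The function `r L_{Z_j} H₃ + L_{Z_j} K₁`. When both of these vanish at `shift x m`, the row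
vector `(r, 1)` annihilates `𝒢(x)`, so that `r = ρ(x)`. -/
def kerRel (r : ℂ) (j : Fin 2) (m : Phase) : ℂ := r * lieZ H3 j m + lieZ K1 j m

theorem differentiable_lieZ_H3 (j : Fin 2) : Differentiable ℂ (lieZ H3 j) := by
  fin_cases j
  · exact (funext lieZ_H3_zero).symm ▸ by fun_prop
  · exact (funext lieZ_H3_one).symm ▸ by fun_prop

theorem differentiable_lieZ_K1 (j : Fin 2) : Differentiable ℂ (lieZ K1 j) := by
  fin_cases j
  · exact (funext lieZ_K1_zero).symm ▸ by fun_prop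
  · exact (funext lieZ_K1_one).symm ▸ by fun_prop

theorem grad_kerRel_zero (r : ℂ) (m : Phase) : grad (kerRel r 0) m =
    vec ![-r * (bc m 1 * bc m 2 + ac m 1), cc m 0 * cc m 2 - r * (bc m 0 * bc m 2),
        -r * (bc m 0 * bc m 1 + ac m 0), 0]
      ![-r * bc m 2 - ac m 1 * cc m 2, -r * bc m 0 - ac m 0 * cc m 2, 0, 0]
      ![bc m 1 * cc m 2 - r, 0, bc m 1 * cc m 0 - ac m 0 * ac m 1, 0] := by
  refine grad_eq fun v => ?_
  unfold kerRel
  simp (disch := fun_prop) only [lieZ_H3_zero, lieZ_K1_zero, fderiv_fun_add, fderiv_fun_sub,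
    fderiv_fun_neg, fderiv_const_mul, fderiv_fun_mul, _root_.add_apply, _root_.sub_apply,
    _root_.neg_apply, _root_.smul_apply, smul_eq_mul, fderiv_bc, fderiv_ac, fderiv_cc,
    dotProduct_phase, bc_vec, ac_vec, cc_vec, Fin.sum_univ_four, Fin.isValue, cons_val]
  ring

theorem grad_kerRel_one (r : ℂ) (m : Phase) : grad (kerRel r 1) m =
    vec ![0, r * bc m 2 + ac m 2 * cc m 0, r * bc m 1 + ac m 0 * cc m 1, 0]
      ![bc m 2 * cc m 1 - ac m 1 * ac m 2, r - ac m 0 * ac m 2,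
        bc m 1 * cc m 0 - ac m 0 * ac m 1, 0]
      ![bc m 1 * ac m 2 + cc m 1, bc m 2 * ac m 0 + cc m 0, 0, 0] := by
  refine grad_eq fun v => ?_
  unfold kerRel
  simp (disch := fun_prop) only [lieZ_H3_one, lieZ_K1_one, fderiv_fun_add, fderiv_fun_sub,
    fderiv_const_mul, fderiv_fun_mul, _root_.add_apply, _root_.sub_apply,
    _root_.smul_apply, smul_eq_mul, fderiv_bc, fderiv_ac, fderiv_cc,
    dotProduct_phase, bc_vec, ac_vec, cc_vec, Fin.sum_univ_four, Fin.isValue, cons_val]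
  ring

theorem bivP'_mulVec_grad_kerRel_zero {r : ℂ} {m : Phase} (h₀ : kerRel r 0 m = 0)
    (h₁ : kerRel r 1 m = 0) : ∃ a : Fin 2 → ℂ, bivP' m *ᵥ grad (kerRel r 0) m = ∑ i, a i • Z i := by
  simp only [kerRel, lieZ_H3_zero, lieZ_H3_one, lieZ_K1_zero, lieZ_K1_one] at h₀ h₁
  rw [bivP'_mulVec, grad_kerRel_zero]
  refine exists_eq_sum_smul_Z ?_ ?_ ?_ <;> intro i <;> fin_cases i <;>
    simp only [bc_vec, ac_vec, cc_vec, Fin.isValue, Fin.zero_eta, Fin.mk_one, Fin.reduceFinMk,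
      Fin.reduceAdd, cons_val, ne_eq, not_true_eq_false, Fin.reduceEq, not_false_eq_true,
      IsEmpty.forall_iff, forall_const]
  · ring
  · ring
  · ring
  · ring
  · ring
  · linear_combination ac m 2 * h₀ - cc m 2 * h₁
  · ring
  · linear_combination cc m 1 * h₀
  · ring
  · linear_combination -cc m 3 * h₀

theorem bivP'_mulVec_grad_kerRel_one {r : ℂ} {m : Phase} (h₀ : kerRel r 0 m = 0)
    (h₁ : kerRel r 1 m = 0) : ∃ a : Fin 2 → ℂ, bivP' m *ᵥ grad (kerRel r 1) m = ∑ i, a i • Z i := by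
  simp only [kerRel, lieZ_H3_zero, lieZ_H3_one, lieZ_K1_zero, lieZ_K1_one] at h₀ h₁
  rw [bivP'_mulVec, grad_kerRel_one]
  refine exists_eq_sum_smul_Z ?_ ?_ ?_ <;> intro i <;> fin_cases i <;>
    simp only [bc_vec, ac_vec, cc_vec, Fin.isValue, Fin.zero_eta, Fin.mk_one, Fin.reduceFinMk,
      Fin.reduceAdd, cons_val, ne_eq, not_true_eq_false, Fin.reduceEq, not_false_eq_true,
      IsEmpty.forall_iff, forall_const]
  · linear_combination -h₀ - bc m 0 * h₁
  · ring
  · ring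
  · linear_combination -ac m 0 * h₁
  · ring
  · linear_combination ac m 2 * h₁
  · linear_combination -cc m 0 * h₁
  · linear_combination cc m 1 * h₁
  · linear_combination cc m 2 * h₁
  · linear_combination -cc m 3 * h₁

theorem grad_kerRel_zero_dotProduct_grad_kerRel_one {r : ℂ} {m : Phase} (h₀ : kerRel r 0 m = 0)
    (h₁ : kerRel r 1 m = 0) :
    grad (kerRel r 0) m ⬝ᵥ bivP m *ᵥ grad (kerRel r 1) m =
      r * (grad (kerRel r 0) m ⬝ᵥ vec 1 0 0 * lieZ H3 1 m
        - grad (kerRel r 1) m ⬝ᵥ vec 1 0 0 * lieZ H3 0 m) := by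
  simp only [kerRel, lieZ_H3_zero, lieZ_H3_one, lieZ_K1_zero, lieZ_K1_one] at h₀ h₁
  rw [bivP_mulVec, grad_kerRel_zero, grad_kerRel_one]
  simp only [lieZ_H3_zero, lieZ_H3_one, dotProduct_phase, bc_vec, ac_vec, cc_vec,
    Fin.sum_univ_four, Fin.isValue, Fin.reduceAdd, cons_val, Pi.one_apply, Pi.zero_apply]
  linear_combination (ac m 0 * cc m 1 + ac m 2 * cc m 0) * h₀
    + (r * (bc m 1 * bc m 2 + ac m 1) - cc m 0 * cc m 2) * h₁

theorem bivP'_mulVec_grad_kerRel {r : ℂ} {m : Phase} (h : ∀ j, kerRel r j m = 0) (j : Fin 2) :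
    ∃ a : Fin 2 → ℂ, bivP' m *ᵥ grad (kerRel r j) m = ∑ i, a i • Z i := by
  fin_cases j
  exacts [bivP'_mulVec_grad_kerRel_zero (h 0) (h 1), bivP'_mulVec_grad_kerRel_one (h 0) (h 1)]

theorem grad_kerRel_dotProduct_Z (r : ℂ) (j : Fin 2) (m : Phase) (i : Fin 2) :
    grad (kerRel r j) m ⬝ᵥ Z i = 0 := by
  fin_cases j <;> fin_cases i <;>
    simp only [Fin.zero_eta, Fin.mk_one, Fin.isValue, dotProduct_Z_zero, dotProduct_Z_one,
      grad_kerRel_zero, grad_kerRel_one, bc_vec, ac_vec, cons_val, neg_zero]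

section Polynomial

open Polynomial

/-- The matrix `𝒢`, with entries in `ℂ[x]`. -/
def calGPoly (m : Phase) : Matrix (Fin 2) (Fin 2) ℂ[X] :=
  let b : Fin 4 → ℂ[X] := fun i => C (bc m i) - X
  !![-(b 0 * b 1 * b 2 + b 0 * C (ac m 1) + b 2 * C (ac m 0) + C (cc m 0)),
      b 1 * b 2 + C (ac m 1);
    b 1 * C (cc m 0 * cc m 2) - C (ac m 0 * ac m 1 * cc m 2),
      b 1 * C (ac m 2 * cc m 0) + b 2 * C (ac m 0 * cc m 1) - C (ac m 0 * ac m 1 * ac m 2)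
        + C (cc m 0 * cc m 1)]

theorem eval_calGPoly (m : Phase) (x : ℂ) (i j : Fin 2) :
    (calGPoly m i j).eval x = calG m x i j := by
  fin_cases i <;> fin_cases j <;>
    simp [calGPoly, calG_apply_zero, calG_apply_one, lieZ_H3_zero, lieZ_H3_one,
      lieZ_K1_zero, lieZ_K1_one, bc_shift, ac_shift, cc_shift] <;> ring

/-- The characteristic polynomial `det 𝒢`, whose roots are the coordinates `λ_i`. -/
def detPoly (m : Phase) : ℂ[X] := (calGPoly m).det

theorem eval_detPoly (m : Phase) (x : ℂ) : (detPoly m).eval x = (calG m x).det := by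
  simp only [detPoly, det_fin_two, eval_sub, eval_mul, eval_calGPoly]

theorem natDegree_detPoly_le (m : Phase) : (detPoly m).natDegree ≤ 4 := by
  simp only [detPoly, det_fin_two, calGPoly, of_apply, cons_val]
  compute_degree

theorem coeff_detPoly (m : Phase) : (detPoly m).coeff 4 = -(redG m).det := by
  have h₀₀ : (calGPoly m 0 0).natDegree ≤ 3 ∧ (calGPoly m 0 0).coeff 3 = 1 := by
    have h : calGPoly m 0 0 = X ^ 3 - C (bc m 0 + bc m 1 + bc m 2) * X ^ 2
        + C (bc m 0 * bc m 1 + bc m 0 * bc m 2 + bc m 1 * bc m 2 + ac m 0 + ac m 1) * X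
        - C (bc m 0 * bc m 1 * bc m 2 + bc m 0 * ac m 1 + bc m 2 * ac m 0 + cc m 0) := by
      simp only [calGPoly, of_apply, cons_val, C_add, C_mul]
      ring
    rw [h]
    constructor
    · compute_degree
    · compute_degree!
  have h₁₁ : (calGPoly m 1 1).natDegree ≤ 1 ∧
      (calGPoly m 1 1).coeff 1 = -(ac m 0 * cc m 1 + ac m 2 * cc m 0) := by
    simp only [calGPoly, of_apply, cons_val]
    constructor
    · compute_degree
    · compute_degree!
  have h₀₁ : (calGPoly m 0 1 * calGPoly m 1 0).natDegree ≤ 3 := by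
    simp only [calGPoly, of_apply, cons_val]
    compute_degree
  rw [detPoly, det_fin_two, coeff_sub, coeff_eq_zero_of_natDegree_lt (h₀₁.trans_lt (by simp)),
    sub_zero, coeff_mul_add_eq_of_natDegree_le h₀₀.1 h₁₁.1, h₀₀.2, h₁₁.2, one_mul, det_redG]

theorem eval_derivative_detPoly {r x : ℂ} {m : Phase} (h : ∀ j, kerRel r j (shift x m) = 0) :
    (detPoly m).derivative.eval x =
      grad (kerRel r 0) (shift x m) ⬝ᵥ vec 1 0 0 * lieZ H3 1 (shift x m)
        - grad (kerRel r 1) (shift x m) ⬝ᵥ vec 1 0 0 * lieZ H3 0 (shift x m) := by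
  have h₀ := h 0
  have h₁ := h 1
  simp only [kerRel, lieZ_H3_zero, lieZ_H3_one, lieZ_K1_zero, lieZ_K1_one, bc_shift, ac_shift,
    cc_shift] at h₀ h₁
  simp only [grad_kerRel_zero, grad_kerRel_one, lieZ_H3_zero, lieZ_H3_one, bc_shift, ac_shift,
    cc_shift, dotProduct_phase, bc_vec, ac_vec, cc_vec, Fin.sum_univ_four, Fin.isValue, cons_val,
    Pi.one_apply, Pi.zero_apply, detPoly, det_fin_two, calGPoly, of_apply, derivative_sub,
    derivative_add, derivative_neg, derivative_mul, derivative_C, derivative_X, eval_sub, eval_add,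
    eval_mul, eval_neg, eval_C, eval_X, eval_zero, eval_one]
  linear_combination (bc m 1 - x + (bc m 2 - x)) * h₀
    + ((bc m 1 - x) * (bc m 2 - x) + (bc m 0 - x) * (bc m 2 - x) + (bc m 0 - x) * (bc m 1 - x)
      + ac m 1 + ac m 0) * h₁

theorem derivative_eval_ne_zero_of_injective {R ι : Type*} [CommRing R] [IsDomain R] [Fintype ι]
    {p : R[X]} (hp : p ≠ 0) (hn : p.natDegree ≤ Fintype.card ι) {z : ι → R}
    (hz : Function.Injective z) (h : ∀ i, p.IsRoot (z i)) (i : ι) :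
    p.derivative.eval (z i) ≠ 0 := by
  classical
  have hnd : (Finset.univ.val.map z).Nodup := Finset.univ.nodup.map hz
  have hroots : Finset.univ.val.map z = p.roots := by
    refine Multiset.eq_of_le_of_card_le ((Multiset.le_iff_subset hnd).2 fun x hx => ?_) ?_
    · obtain ⟨j, -, rfl⟩ := Multiset.mem_map.1 hx
      exact (mem_roots hp).2 (h j)
    · simpa using (card_roots' p).trans hn
  intro h'
  have := (one_lt_rootMultiplicity_iff_isRoot hp).2 ⟨h i, h'⟩
  rw [← count_roots] at this
  exact this.not_ge (Multiset.nodup_iff_count_le_one.1 (hroots ▸ hnd) _)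

theorem eval_derivative_detPoly_ne_zero {m : Phase} {z : Fin 4 → ℂ} (hG : (redG m).det ≠ 0)
    (hz : Function.Injective z) (hroot : ∀ i, (calG m (z i)).det = 0) (i : Fin 4) :
    (detPoly m).derivative.eval (z i) ≠ 0 := by
  have hne : detPoly m ≠ 0 := fun h0 => hG <| by
    rw [← neg_eq_zero, ← coeff_detPoly, h0, Polynomial.coeff_zero]
  refine derivative_eval_ne_zero_of_injective hne ?_ hz
    (fun j => (eval_detPoly _ _).trans (hroot j)) i
  rw [Fintype.card_fin]
  exact natDegree_detPoly_le m

end Polynomial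

/-! ### The reduced pencil on the leaves -/

theorem redG_eq (m : Phase) : redG m = pairing Z ![grad H0 m, grad K0 m] := by
  ext i j
  fin_cases j
  exacts [fderiv_apply H0 m (Z i), fderiv_apply K0 m (Z i)]

theorem bivQ_eq (m : Phase) : bivQ m = reducedBivector (bivP' m) Z ![grad H0 m, grad K0 m] := by
  have hdF : ∀ j, sharp (bivP' m) (dF m j) = bivP' m *ᵥ ![grad H0 m, grad K0 m] j := by
    intro j
    fin_cases j
    exacts [sharp_fderiv _ H0 m, sharp_fderiv _ K0 m]
  simp only [bivQ, reducedBivector, wedge, redG_eq, hdF]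

theorem transpose_bivQ (m : Phase) : (bivQ m)ᵀ = -bivQ m := by
  rw [bivQ_eq, transpose_reducedBivector (transpose_bivP' m)]

theorem grad_reduced_involution (m : Phase) (j k : Fin 2) :
    ![grad H0 m, grad K0 m] k ⬝ᵥ bivP' m *ᵥ ![grad H0 m, grad K0 m] j = 0 := by
  fin_cases j <;> fin_cases k
  · exact dotProduct_mulVec_self_of_skew (transpose_bivP' m) _
  · exact grad_K0_dotProduct_bivP'_grad_H0 m
  · exact (dotProduct_mulVec_of_skew (transpose_bivP' m) _ _).trans
      (neg_eq_zero.mpr (grad_K0_dotProduct_bivP'_grad_H0 m))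
  · exact dotProduct_mulVec_self_of_skew (transpose_bivP' m) _

theorem bivQ_mulVec_eq_smul {m g : Phase} (hG : (redG m).det ≠ 0) (hg : ∀ i, g ⬝ᵥ Z i = 0) {x : ℂ}
    {a : Fin 2 → ℂ} (hPg : bivP' m *ᵥ g = x • bivP m *ᵥ g + ∑ i, a i • Z i) :
    bivQ m *ᵥ g = x • bivP m *ᵥ g := by
  rw [bivQ_eq]
  refine reducedBivector_mulVec_eq_smul (transpose_bivP m) (transpose_bivP' m)
    (redG_eq m ▸ isUnit_iff_ne_zero.mpr hG) (grad_reduced_involution m) (fun j => ?_) hg hPg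
  fin_cases j
  exacts [bivP_mulVec_grad_H0 m, bivP_mulVec_grad_K0 m]

theorem bivP_mulVec_grad_casimirs (m : Phase) (i : Fin 4) :
    bivP m *ᵥ grad (fun p => casimirs p i) m = 0 := by
  fin_cases i
  exacts [bivP_mulVec_grad_H0 m, bivP_mulVec_grad_K0 m, bivP_mulVec_grad_J1 m,
    bivP_mulVec_grad_J2 m]

theorem bivQ_mulVec_grad_casimirs {m : Phase} (hG : (redG m).det ≠ 0) (i : Fin 4) :
    bivQ m *ᵥ grad (fun p => casimirs p i) m = 0 := by
  have hF : ∀ k, bivQ m *ᵥ ![grad H0 m, grad K0 m] k = 0 := fun k => by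
    rw [bivQ_eq]
    exact reducedBivector_mulVec_casimir (redG_eq m ▸ isUnit_iff_ne_zero.mpr hG)
      fun j => grad_reduced_involution m j k
  have hJ : ∀ g : Phase, bc g = 0 → ac g = 0 → bivP' m *ᵥ g = 0 → bivQ m *ᵥ g = 0 := by
    intro g hb ha hg
    refine (bivQ_mulVec_eq_smul (x := 0) (a := 0) hG (fun i => ?_) ?_).trans (zero_smul _ _)
    · fin_cases i
      · exact (dotProduct_Z_zero g).trans (by rw [hb, Pi.zero_apply, neg_zero])
      · exact (dotProduct_Z_one g).trans (by rw [ha, Pi.zero_apply])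
    · simp only [hg, zero_smul, Pi.zero_apply, Finset.sum_const_zero, add_zero]
  fin_cases i
  exacts [hF 0, hF 1,
    hJ (grad J1 m) (by rw [grad_J1, bc_vec]) (by rw [grad_J1, ac_vec]) (bivP'_mulVec_grad_J1 m),
    hJ (grad J2 m) (by rw [grad_J2, bc_vec]) (by rw [grad_J2, ac_vec]) (bivP'_mulVec_grad_J2 m)]

theorem bivQ_mulVec_grad_kerRel {m : Phase} (hG : (redG m).det ≠ 0) {r x : ℂ}
    (h : ∀ j, kerRel r j (shift x m) = 0) (j : Fin 2) :
    bivQ m *ᵥ grad (kerRel r j) (shift x m) = x • bivP m *ᵥ grad (kerRel r j) (shift x m) := by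
  obtain ⟨a, ha⟩ := bivP'_mulVec_grad_kerRel h j
  refine bivQ_mulVec_eq_smul hG (grad_kerRel_dotProduct_Z r j _) (a := a) ?_
  rw [← ha, bivP'_shift_mulVec, add_sub_cancel]

theorem differentiable_casimirs_apply (i : Fin 4) : Differentiable ℂ fun p => casimirs p i := by
  fin_cases i
  exacts [differentiable_H0, differentiable_K0, differentiable_J1, differentiable_J2]

theorem fderiv_casimirs (m v : Phase) :
    fderiv ℂ casimirs m v = fun i => grad (fun p => casimirs p i) m ⬝ᵥ v := by
  ext i
  rw [← fderiv_apply, fderiv_pi fun i => differentiable_casimirs_apply i m,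
    ContinuousLinearMap.pi_apply]

theorem mem_leafTangent {m v : Phase} :
    v ∈ leafTangent m ↔ ∀ i, grad (fun p => casimirs p i) m ⬝ᵥ v = 0 := by
  rw [leafTangent, LinearMap.mem_ker, ContinuousLinearMap.coe_coe, fderiv_casimirs, funext_iff]
  rfl

theorem bivP_mulVec_mem_leafTangent (m g : Phase) : bivP m *ᵥ g ∈ leafTangent m :=
  mem_leafTangent.mpr fun i => by
    rw [dotProduct_mulVec_of_skew (transpose_bivP m), bivP_mulVec_grad_casimirs, dotProduct_zero,
      neg_zero]

theorem bivQ_mulVec_mem_leafTangent {m : Phase} (hG : (redG m).det ≠ 0) (g : Phase) :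
    bivQ m *ᵥ g ∈ leafTangent m :=
  mem_leafTangent.mpr fun i => by
    rw [dotProduct_mulVec_of_skew (transpose_bivQ m), bivQ_mulVec_grad_casimirs hG,
      dotProduct_zero, neg_zero]

theorem surjective_fderiv_casimirs {m : Phase}
    (hm : LinearIndependent ℂ fun i => grad (fun p => casimirs p i) m) :
    Function.Surjective (fderiv ℂ casimirs m) := fun w =>
  (exists_dotProduct_eq_of_linearIndependent hm w).imp fun v hv => by
    rw [fderiv_casimirs]; exact funext hv

theorem finrank_leafTangent {m : Phase} (hm : Function.Surjective (fderiv ℂ casimirs m)) :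
    Module.finrank ℂ (leafTangent m) = 8 := by
  have h := LinearMap.finrank_range_add_finrank_ker (fderiv ℂ casimirs m : Phase →ₗ[ℂ] (Fin 4 → ℂ))
  rw [LinearMap.range_eq_top.mpr hm, finrank_top, Module.finrank_fin_fun,
    Module.finrank_fintype_fun_eq_card, Fintype.card_sum, Fintype.card_sum, Fintype.card_fin] at h
  rw [leafTangent]
  lia

/-- The gradients of `H₀, K₀, J₁, J₂` and `H₁, H₂, H₃, K₁`. -/
def gradients (m : Phase) : Fin 4 ⊕ Fin 4 → Phase :=
  Sum.elim (fun i => grad (fun p => casimirs p i) m) fun i => grad (fun p => hams p i) m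

theorem linearIndependent_gradients_iff {m : Phase} :
    LinearIndependent ℂ (gradients m) ↔ LinearIndependent ℂ
      (Sum.elim (fun i : Fin 4 => fderiv ℂ (fun x => casimirs x i) m)
        fun i : Fin 4 => fderiv ℂ (fun x => hams x i) m) := by
  rw [← LinearMap.linearIndependent_iff (covec.symm : (Phase →L[ℂ] ℂ) →ₗ[ℂ] Phase)
    (LinearEquiv.ker _), Sum.comp_elim]
  rfl

/-! ### Differentials of the branches -/

section Branches

variable {V : Set Phase} {lam mu : Fin 4 → Phase → ℂ} {m : Phase}

theorem differentiable_kerRel (r : ℂ) (j : Fin 2) : Differentiable ℂ (kerRel r j) :=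
  ((differentiable_lieZ_H3 j).const_mul r).add (differentiable_lieZ_K1 j)

theorem IsBranch.kerRel_eq_zero (h : IsBranch V lam mu) (hm : m ∈ V) (i : Fin 4) (j : Fin 2) :
    kerRel (Complex.exp (mu i m)) j (shift (lam i m) m) = 0 := by
  have hden := h.denom_ne m hm i
  have hone : Complex.exp (mu i m) * calG m (lam i m) 0 1 + calG m (lam i m) 1 1 = 0 := by
    rw [h.exp_mu m hm i, rho, div_mul_cancel₀ _ hden, neg_add_cancel]
  have hzero : Complex.exp (mu i m) * calG m (lam i m) 0 0 + calG m (lam i m) 1 0 = 0 := by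
    have hdet := h.root m hm i
    rw [det_fin_two] at hdet
    refine mul_left_cancel₀ hden ?_
    linear_combination calG m (lam i m) 0 0 * hone - hdet
  rw [kerRel, ← calG_apply_zero, ← calG_apply_one]
  fin_cases j
  exacts [hzero, hone]

theorem IsBranch.grad_kerRel (h : IsBranch V lam mu) (hm : m ∈ V) (i : Fin 4) (j : Fin 2) :
    grad (kerRel (Complex.exp (mu i m)) j) (shift (lam i m) m) =
      (grad (kerRel (Complex.exp (mu i m)) j) (shift (lam i m) m) ⬝ᵥ vec 1 0 0) • grad (lam i) m
        + (-(Complex.exp (mu i m) * lieZ H3 j (shift (lam i m) m))) • grad (mu i) m := by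
  have hnhds := h.isOpen.mem_nhds hm
  set r := Complex.exp (mu i m)
  set n := shift (lam i m) m
  have hlam := ((h.lam_holo i).differentiableAt hnhds).hasFDerivAt
  have hmu := ((h.mu_holo i).differentiableAt hnhds).hasFDerivAt
  have hshift : HasFDerivAt (fun p => shift (lam i p) p) _ m :=
    (hasFDerivAt_id m).fun_sub (hlam.smul_const (vec 1 0 0))
  have hker := (differentiable_kerRel r j n).hasFDerivAt.comp m hshift
  have hlie := (differentiable_lieZ_H3 j n).hasFDerivAt.comp m hshift
  -- The relation vanishing on `V`, with the variation of `exp μ` separated from that of `λ`.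
  have hsum := hker.add ((hmu.cexp.sub_const r).mul hlie)
  have hzero := hsum.unique ((hasFDerivAt_const (0 : ℂ) m).congr_of_eventuallyEq
    (Filter.eventuallyEq_of_mem hnhds fun p hp => ?_))
  · refine covec.injective (ContinuousLinearMap.ext fun v => ?_)
    have hv := DFunLike.congr_fun hzero v
    simp only [_root_.add_apply, _root_.sub_apply, _root_.smul_apply, _root_.zero_apply,
      ContinuousLinearMap.comp_apply, ContinuousLinearMap.smulRight_apply,
      ContinuousLinearMap.id_apply, Function.comp_apply,
      smul_eq_mul, fderiv_apply, dotProduct_sub, dotProduct_smul] at hv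
    simp only [covec_apply, add_dotProduct, smul_dotProduct, smul_eq_mul]
    linear_combination hv
  · have hp0 := h.kerRel_eq_zero hp i j
    simp only [kerRel, Pi.add_apply, Pi.mul_apply, Function.comp_apply] at hp0 ⊢
    linear_combination hp0

theorem IsBranch.canonical (h : IsBranch V lam mu) (hm : m ∈ V) (hG : (redG m).det ≠ 0)
    (i : Fin 4) :
    bivQ m *ᵥ grad (lam i) m = lam i m • bivP m *ᵥ grad (lam i) m ∧
      bivQ m *ᵥ grad (mu i) m = lam i m • bivP m *ᵥ grad (mu i) m ∧
      grad (mu i) m ⬝ᵥ bivP m *ᵥ grad (lam i) m = 1 := by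
  set r := Complex.exp (mu i m)
  set n := shift (lam i m) m
  have hker : ∀ j, kerRel r j n = 0 := h.kerRel_eq_zero hm i
  have hgrad := h.grad_kerRel hm i
  have hdet : (grad (kerRel r 0) n ⬝ᵥ vec 1 0 0) * -(r * lieZ H3 1 n)
      - (grad (kerRel r 1) n ⬝ᵥ vec 1 0 0) * -(r * lieZ H3 0 n)
      = -(r * (detPoly m).derivative.eval (lam i m)) := by
    rw [eval_derivative_detPoly hker]
    ring
  have hne : (grad (kerRel r 0) n ⬝ᵥ vec 1 0 0) * -(r * lieZ H3 1 n)
      - (grad (kerRel r 1) n ⬝ᵥ vec 1 0 0) * -(r * lieZ H3 0 n) ≠ 0 := by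
    rw [hdet]
    exact neg_ne_zero.mpr (mul_ne_zero (Complex.exp_ne_zero _)
      (eval_derivative_detPoly_ne_zero hG (h.distinct m hm) (h.root m hm) i))
  let W := LinearMap.ker (bivQ m - lam i m • bivP m).mulVecLin
  have hW : ∀ g, g ∈ W ↔ bivQ m *ᵥ g = lam i m • bivP m *ᵥ g := fun g => by
    rw [LinearMap.mem_ker, mulVecLin_apply, sub_mulVec, smul_mulVec, sub_eq_zero]
  have hω : ∀ j, grad (kerRel r j) n ∈ W := fun j =>
    (hW _).mpr (bivQ_mulVec_grad_kerRel hG hker j)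
  obtain ⟨hl, hu⟩ := mem_and_mem_of_combinations hne (hgrad 0 ▸ hω 0) (hgrad 1 ▸ hω 1)
  refine ⟨(hW _).mp hl, (hW _).mp hu, mul_left_cancel₀ (neg_ne_zero.mpr hne) ?_⟩
  rw [← dotProduct_mulVec_combinations (transpose_bivP m), ← hgrad 0, ← hgrad 1,
    ← bivP_shift (lam i m),
    grad_kerRel_zero_dotProduct_grad_kerRel_one (hker 0) (hker 1)]
  ring

theorem IsBranch.lam_lam (h : IsBranch V lam mu) (hm : m ∈ V) (hG : (redG m).det ≠ 0)
    (i j : Fin 4) : grad (lam i) m ⬝ᵥ bivP m *ᵥ grad (lam j) m = 0 := by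
  rcases eq_or_ne i j with rfl | hij
  · exact dotProduct_mulVec_self_of_skew (transpose_bivP m) _
  · exact dotProduct_mulVec_eq_zero_of_pencil (transpose_bivP m) (transpose_bivQ m)
      ((h.distinct m hm).ne hij) (h.canonical hm hG i).1 (h.canonical hm hG j).1

theorem IsBranch.mu_mu (h : IsBranch V lam mu) (hm : m ∈ V) (hG : (redG m).det ≠ 0)
    (i j : Fin 4) : grad (mu i) m ⬝ᵥ bivP m *ᵥ grad (mu j) m = 0 := by
  rcases eq_or_ne i j with rfl | hij
  · exact dotProduct_mulVec_self_of_skew (transpose_bivP m) _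
  · exact dotProduct_mulVec_eq_zero_of_pencil (transpose_bivP m) (transpose_bivQ m)
      ((h.distinct m hm).ne hij) (h.canonical hm hG i).2.1 (h.canonical hm hG j).2.1

theorem IsBranch.mu_lam (h : IsBranch V lam mu) (hm : m ∈ V) (hG : (redG m).det ≠ 0)
    (i j : Fin 4) : grad (mu i) m ⬝ᵥ bivP m *ᵥ grad (lam j) m = if i = j then 1 else 0 := by
  rcases eq_or_ne i j with rfl | hij
  · rw [(h.canonical hm hG i).2.2, if_pos rfl]
  · rw [if_neg hij]
    exact dotProduct_mulVec_eq_zero_of_pencil (transpose_bivP m) (transpose_bivQ m)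
      ((h.distinct m hm).ne hij) (h.canonical hm hG i).2.1 (h.canonical hm hG j).1

theorem IsBranch.lam_mu (h : IsBranch V lam mu) (hm : m ∈ V) (hG : (redG m).det ≠ 0)
    (i j : Fin 4) : grad (lam i) m ⬝ᵥ bivP m *ᵥ grad (mu j) m = -if i = j then 1 else 0 := by
  rw [dotProduct_mulVec_of_skew (transpose_bivP m), h.mu_lam hm hG]
  simp only [eq_comm]

/-! ### Darboux–Nijenhuis coordinates -/

/-- The differentials of the coordinates `(λ, μ)`, restricted to the tangent space of the leaf. -/
def coordMap (lam mu : Fin 4 → Phase → ℂ) (m : Phase) :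
    leafTangent m →ₗ[ℂ] (Fin 4 ⊕ Fin 4 → ℂ) :=
  LinearMap.pi fun s => (fderiv ℂ (Sum.elim lam mu s) m : Phase →ₗ[ℂ] ℂ).domRestrict _

theorem coordMap_apply (lam mu : Fin 4 → Phase → ℂ) (m : Phase) (v : leafTangent m)
    (s : Fin 4 ⊕ Fin 4) : coordMap lam mu m v s = grad (Sum.elim lam mu s) m ⬝ᵥ (v : Phase) :=
  fderiv_apply _ m v

/-- A covector whose image under `P` has prescribed components in the coordinates `(λ, μ)`. -/
def coordInv (lam mu : Fin 4 → Phase → ℂ) (m : Phase) (w : Fin 4 ⊕ Fin 4 → ℂ) : Phase :=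
  ∑ j, (w (Sum.inr j) • grad (lam j) m - w (Sum.inl j) • grad (mu j) m)

theorem IsBranch.coordMap_coordInv (h : IsBranch V lam mu) (hm : m ∈ V) (hG : (redG m).det ≠ 0)
    (w : Fin 4 ⊕ Fin 4 → ℂ) :
    coordMap lam mu m ⟨bivP m *ᵥ coordInv lam mu m w, bivP_mulVec_mem_leafTangent m _⟩ = w := by
  ext s
  rw [coordMap_apply]
  simp only [coordInv, mulVec_sum, mulVec_sub, mulVec_smul, dotProduct_sum, dotProduct_sub,
    dotProduct_smul, smul_eq_mul]
  rcases s with i | i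
  · simp [h.lam_lam hm hG, h.lam_mu hm hG]
  · simp [h.mu_lam hm hG, h.mu_mu hm hG]

theorem IsBranch.bijective_coordMap (h : IsBranch V lam mu) (hm : m ∈ V) (hr : m ∈ regularSet) :
    Function.Bijective (coordMap lam mu m) := by
  have hsurj : Function.Surjective (coordMap lam mu m) := fun w =>
    ⟨_, h.coordMap_coordInv hm hr.1 w⟩
  refine ⟨(LinearMap.injective_iff_surjective_of_finrank_eq_finrank ?_).mpr hsurj, hsurj⟩
  rw [finrank_leafTangent (surjective_fderiv_casimirs
    ((linearIndependent_gradients_iff.2 hr.2.2).comp Sum.inl Sum.inl_injective)),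
    Module.finrank_fintype_fun_eq_card, Fintype.card_sum, Fintype.card_fin]

theorem IsBranch.isSymplecticAt (h : IsBranch V lam mu) (hm : m ∈ V) (hr : m ∈ regularSet) :
    IsSymplecticAt m := by
  refine ⟨surjective_fderiv_casimirs
    ((linearIndependent_gradients_iff.2 hr.2.2).comp Sum.inl Sum.inl_injective),
    Set.Subset.antisymm ?_ ?_⟩
  · rintro _ ⟨α, rfl⟩
    exact bivP_mulVec_mem_leafTangent m _
  · intro v hv
    refine ⟨covec (coordInv lam mu m (coordMap lam mu m ⟨v, hv⟩)), ?_⟩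
    rw [sharp_covec]
    exact congrArg Subtype.val ((h.bijective_coordMap hm hr).1 (h.coordMap_coordInv hm hr.1 _))

theorem IsBranch.coordMap_bivQ (h : IsBranch V lam mu) (hm : m ∈ V) (hG : (redG m).det ≠ 0)
    (g : Phase) (s : Fin 4 ⊕ Fin 4) :
    coordMap lam mu m ⟨bivQ m *ᵥ g, bivQ_mulVec_mem_leafTangent hG g⟩ s =
      lam (s.elim id id) m *
        coordMap lam mu m ⟨bivP m *ᵥ g, bivP_mulVec_mem_leafTangent m g⟩ s := by
  rw [coordMap_apply, coordMap_apply, dotProduct_mulVec_of_skew (transpose_bivQ m),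
    dotProduct_mulVec_of_skew (transpose_bivP m), mul_neg, ← smul_eq_mul, ← dotProduct_smul]
  rcases s with i | i
  · exact congrArg (fun v => -(g ⬝ᵥ v)) (h.canonical hm hG i).1
  · exact congrArg (fun v => -(g ⬝ᵥ v)) (h.canonical hm hG i).2.1

theorem IsBranch.exists_nijenhuisOperator (h : IsBranch V lam mu) (hm : m ∈ V)
    (hr : m ∈ regularSet) : ∃ N : leafTangent m →ₗ[ℂ] leafTangent m, IsNijenhuisOperator m N ∧
      ∀ v s, coordMap lam mu m (N v) s = lam (s.elim id id) m * coordMap lam mu m v s := by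
  have hb := h.bijective_coordMap hm hr
  let e := LinearEquiv.ofBijective (coordMap lam mu m) hb
  let D : (Fin 4 ⊕ Fin 4 → ℂ) →ₗ[ℂ] (Fin 4 ⊕ Fin 4 → ℂ) :=
    LinearMap.pi fun s => lam (s.elim id id) m • LinearMap.proj s
  have hN : ∀ v, coordMap lam mu m (e.symm (D (e v))) = D (e v) := fun v => e.apply_symm_apply _
  refine ⟨e.symm.toLinearMap ∘ₗ D ∘ₗ e.toLinearMap, fun α v hv => ?_, fun v s =>
    congrFun (hN v) s⟩
  obtain ⟨g, rfl⟩ := covec.surjective α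
  rw [sharp_covec] at hv ⊢
  obtain rfl : ⟨bivP m *ᵥ g, bivP_mulVec_mem_leafTangent m g⟩ = v := Subtype.ext hv
  refine congrArg Subtype.val (a₂ := ⟨bivQ m *ᵥ g, bivQ_mulVec_mem_leafTangent hr.1 g⟩)
    (hb.1 ((hN _).trans (funext fun s => ?_)))
  exact (h.coordMap_bivQ hm hr.1 g s).symm

theorem IsBranch.isDarbouxNijenhuisAt (h : IsBranch V lam mu) (hm : m ∈ V)
    (hr : m ∈ regularSet) : IsDarbouxNijenhuisAt lam mu m where
  basis := by
    convert h.bijective_coordMap hm hr using 2 with v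
    ext s
    cases s <;> rfl
  bracket_mu_lam i j := by rw [bracket_eq, h.mu_lam hm hr.1]
  bracket_lam i j := by rw [bracket_eq, h.lam_lam hm hr.1]
  bracket_mu i j := by rw [bracket_eq, h.mu_mu hm hr.1]
  nijenhuis := (h.exists_nijenhuisOperator hm hr).imp fun _ hN =>
    ⟨hN.1, fun i v => ⟨hN.2 v (Sum.inl i), hN.2 v (Sum.inr i)⟩⟩

end Branches

/-! ### Integrability -/

theorem grad_H0_dotProduct_bivP_mulVec (m g : Phase) : grad H0 m ⬝ᵥ bivP m *ᵥ g = 0 := by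
  rw [dotProduct_mulVec_of_skew (transpose_bivP m), bivP_mulVec_grad_H0, dotProduct_zero, neg_zero]

theorem grad_dotProduct_bivP_grad_K1 (m : Phase) :
    grad H1 m ⬝ᵥ bivP m *ᵥ grad K1 m = 0 ∧ grad H2 m ⬝ᵥ bivP m *ᵥ grad K1 m = 0 ∧
      grad H3 m ⬝ᵥ bivP m *ᵥ grad K1 m = 0 := by
  have h : ∀ x, x ^ 2 * (grad H1 m ⬝ᵥ bivP m *ᵥ grad K1 m)
      - x * (grad H2 m ⬝ᵥ bivP m *ᵥ grad K1 m) + grad H3 m ⬝ᵥ bivP m *ᵥ grad K1 m = 0 := by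
    intro x
    have hx := grad_polyH_dotProduct_grad_K1 x m
    simp only [grad_polyH_eq, add_dotProduct, sub_dotProduct, neg_dotProduct, smul_dotProduct,
      grad_H0_dotProduct_bivP_mulVec, smul_eq_mul] at hx
    linear_combination hx
  have h₀ := h 0
  have h₁ := h 1
  have h₂ := h (-1)
  refine ⟨?_, ?_, ?_⟩
  · linear_combination (h₁ + h₂) / 2 - h₀
  · linear_combination (h₂ - h₁) / 2
  · linear_combination h₀

theorem grad_dotProduct_bivP_grad_H (m : Phase) :
    grad H1 m ⬝ᵥ bivP m *ᵥ grad H2 m = 0 ∧ grad H1 m ⬝ᵥ bivP m *ᵥ grad H3 m = 0 ∧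
      grad H2 m ⬝ᵥ bivP m *ᵥ grad H3 m = 0 := by
  have hskew := dotProduct_mulVec_of_skew (transpose_bivP m)
  have h : ∀ x y, x ≠ y → (x * y ^ 2 - x ^ 2 * y) * (grad H1 m ⬝ᵥ bivP m *ᵥ grad H2 m)
      + (x ^ 2 - y ^ 2) * (grad H1 m ⬝ᵥ bivP m *ᵥ grad H3 m)
      + (y - x) * (grad H2 m ⬝ᵥ bivP m *ᵥ grad H3 m) = 0 := by
    intro x y hxy
    have hx := grad_polyH_dotProduct_grad_polyH hxy m
    simp only [grad_polyH_eq, add_dotProduct, sub_dotProduct, neg_dotProduct, smul_dotProduct,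
      mulVec_add, mulVec_sub, mulVec_neg, mulVec_smul, dotProduct_add, dotProduct_sub,
      dotProduct_neg, dotProduct_smul, bivP_mulVec_grad_H0, dotProduct_zero,
      grad_H0_dotProduct_bivP_mulVec, dotProduct_mulVec_self_of_skew (transpose_bivP m),
      smul_eq_mul, hskew (grad H2 m) (grad H1 m), hskew (grad H3 m) (grad H1 m),
      hskew (grad H3 m) (grad H2 m)] at hx
    linear_combination hx
  have h₁ := h 0 1 (by norm_num)
  have h₂ := h 0 (-1) (by norm_num)
  have h₃ := h 1 (-1) (by norm_num)
  refine ⟨?_, ?_, ?_⟩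
  · linear_combination (h₃ + h₁ - h₂) / 2
  · linear_combination -(h₁ + h₂) / 2
  · linear_combination (h₁ - h₂) / 2

theorem grad_hams_dotProduct_bivP_grad_hams (m : Phase) (i j : Fin 4) :
    grad (fun p => hams p i) m ⬝ᵥ bivP m *ᵥ grad (fun p => hams p j) m = 0 := by
  obtain ⟨h₁₂, h₁₃, h₂₃⟩ := grad_dotProduct_bivP_grad_H m
  obtain ⟨h₁K, h₂K, h₃K⟩ := grad_dotProduct_bivP_grad_K1 m
  have hlt : ∀ i j : Fin 4, i < j →
      grad (fun p => hams p i) m ⬝ᵥ bivP m *ᵥ grad (fun p => hams p j) m = 0 := by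
    intro i j hij
    fin_cases i <;> fin_cases j <;> first | exact absurd hij (by decide) | skip
    exacts [h₁₂, h₁₃, h₁K, h₂₃, h₂K, h₃K]
  rcases lt_trichotomy i j with hij | rfl | hij
  · exact hlt i j hij
  · exact dotProduct_mulVec_self_of_skew (transpose_bivP m) _
  · rw [dotProduct_mulVec_of_skew (transpose_bivP m), hlt j i hij, neg_zero]

theorem isIntegrableAt {m : Phase} (hr : m ∈ regularSet) : IsIntegrableAt m := by
  refine ⟨fun i j => by rw [bracket_eq, grad_hams_dotProduct_bivP_grad_hams], ?_⟩
  rw [Fintype.linearIndependent_iff]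
  intro c hc i
  obtain ⟨v, hv⟩ := exists_dotProduct_eq_of_linearIndependent
    (linearIndependent_gradients_iff.2 hr.2.2) (Sum.elim 0 (Pi.single i 1))
  have hvt : v ∈ leafTangent m := mem_leafTangent.mpr fun j => hv (Sum.inl j)
  have hham : ∀ j, fderiv ℂ (fun p => hams p j) m v = (Pi.single i 1 : Fin 4 → ℂ) j := fun j =>
    (fderiv_apply _ m v).trans (hv (Sum.inr j))
  simpa [hham, Pi.single_apply] using LinearMap.congr_fun hc ⟨v, hvt⟩

/-! ### The spectral curve and the separation relations -/

theorem todaH_eq (m : Phase) : todaH m = (1 / 2) * H0 m ^ 2 - H1 m := by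
  simp only [todaH, H0, H1, Fin.sum_univ_four]
  ring

theorem det_lax (m : Phase) (x ν : ℂ) (hν : ν ≠ 0) :
    (x • (1 : Matrix (Fin 4) (Fin 4) ℂ) - lax m ν).det
      = spectralFun (casimirs m) (hams m) x (ν ^ 4) := by
  have h : x • (1 : Matrix (Fin 4) (Fin 4) ℂ) - lax m ν =
      !![x - bc m 0, ν, -(cc m 2 / ν ^ 2), -(ac m 3 / ν);
         -(ac m 0 / ν), x - bc m 1, ν, -(cc m 3 / ν ^ 2);
         -(cc m 0 / ν ^ 2), -(ac m 1 / ν), x - bc m 2, ν;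
         ν, -(cc m 1 / ν ^ 2), -(ac m 2 / ν), x - bc m 3] := by
    ext i j
    fin_cases i <;> fin_cases j <;> simp [lax]
  rw [h, det_succ_row_zero]
  simp only [Fin.sum_univ_four, det_fin_three, submatrix_apply, Fin.succAbove, of_apply, cons_val,
    spectralFun, casimirs, hams, H0, H1, H2, H3, K0, K1, J1, J2, Fin.isValue, Fin.reduceAdd,
    Fin.reduceSucc, Fin.reduceCastSucc, Fin.reduceLT, Fin.coe_ofNat_eq_mod, ↓reduceIte]
  field_simp
  ring

section Separation

variable {V : Set Phase} {lam mu : Fin 4 → Phase → ℂ} {m : Phase}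

theorem lieZ_H3_one_mul_spectralFun {x r : ℂ} (hr : r ≠ 0)
    (h : ∀ j, kerRel r j (shift x m) = 0) :
    lieZ H3 1 (shift x m) * spectralFun (casimirs m) (hams m) x r = 0 := by
  have hs : spectralFun (casimirs m) (hams m) x r = ((x ^ 4 + polyH x m) * r ^ 2 - r ^ 3
      + (polyK x m - x ^ 2 * J1 m) * r + J2 m) / r ^ 2 := by
    simp only [spectralFun, casimirs, hams, polyH, polyK, cons_val]
    field_simp
    ring
  rw [hs, polyH_eq, polyK_eq, ← mul_div_assoc, div_eq_zero_iff]
  left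
  have h₀ := h 0
  have h₁ := h 1
  have hJ₂ : J2 m = J2 (shift x m) := by simp only [J2, cc_shift]
  rw [hJ₂]
  generalize shift x m = n at h₀ h₁ ⊢
  simp only [kerRel, lieZ_H3_zero, lieZ_H3_one, lieZ_K1_zero, lieZ_K1_one, H3, K1, J2,
    Fin.sum_univ_four, Fin.isValue, Fin.reduceAdd] at h₀ h₁ ⊢
  linear_combination (-bc n 1 * bc n 2 * bc n 3 * r - bc n 1 * ac n 2 * r
      + bc n 2 * cc n 1 * cc n 3 - bc n 3 * ac n 1 * r - ac n 1 * ac n 2 * cc n 3 - cc n 1 * r) * h₀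
    + (bc n 1 * bc n 2 * ac n 3 * r + bc n 1 * cc n 2 * r + bc n 2 * cc n 3 * r
      + ac n 1 * ac n 3 * r + ac n 1 * cc n 2 * cc n 3 - r ^ 2) * h₁

theorem IsBranch.spectralFun_eq_zero (h : IsBranch V lam mu) (hm : m ∈ V) (i : Fin 4) :
    spectralFun (casimirs m) (hams m) (lam i m) (Complex.exp (mu i m)) = 0 :=
  (mul_eq_zero.1 (lieZ_H3_one_mul_spectralFun (Complex.exp_ne_zero _)
    (h.kerRel_eq_zero hm i))).resolve_left (calG_apply_zero m _ 1 ▸ h.denom_ne m hm i)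

/-- The partial derivatives of the separation relation with respect to the Hamiltonians. -/
def dPhiHam (x r : ℂ) : Fin 4 → ℂ := ![x ^ 2, -x, 1, r⁻¹]

/-- The partial derivatives of the separation relation with respect to the Casimirs. -/
def dPhiCas (x r : ℂ) : Fin 4 → ℂ := ![-x ^ 3, x / r, -(x ^ 2 / r), (r ^ 2)⁻¹]

/-- The partial derivative of `R(x, ρ)` with respect to `x`. -/
def dPhiX (κ h : Fin 4 → ℂ) (x r : ℂ) : ℂ :=
  4 * x ^ 3 + (-(3 * κ 0 * x ^ 2) + 2 * h 0 * x - h 1) + (κ 1 - 2 * κ 2 * x) / r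

/-- The partial derivative of `R(x, exp y)` with respect to `y`, where `r = exp y`. -/
def dPhiY (κ h : Fin 4 → ℂ) (x r : ℂ) : ℂ :=
  -r - (κ 1 * x + h 3 - κ 2 * x ^ 2) / r - 2 * κ 3 / r ^ 2

theorem spectralFun_exp (κ h : Fin 4 → ℂ) (x y : ℂ) : spectralFun κ h x (Complex.exp y) =
    x ^ 4 - Complex.exp y + (-(κ 0 * x ^ 3) + h 0 * x ^ 2 - h 1 * x + h 2)
      + (κ 1 * x + h 3 - κ 2 * x ^ 2) * Complex.exp (-y) + κ 3 * Complex.exp (-y) ^ 2 := by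
  rw [spectralFun, Complex.exp_neg, inv_pow, div_eq_mul_inv, div_eq_mul_inv]

theorem hasFDerivAt_spectralFun {E : Type*} [NormedAddCommGroup E] [NormedSpace ℂ E] {p : E}
    {κ h : E → Fin 4 → ℂ} {x y : E → ℂ} {κ' h' : Fin 4 → E →L[ℂ] ℂ} {x' y' : E →L[ℂ] ℂ}
    (hκ : ∀ i, HasFDerivAt (fun q => κ q i) (κ' i) p)
    (hh : ∀ i, HasFDerivAt (fun q => h q i) (h' i) p)
    (hx : HasFDerivAt x x' p) (hy : HasFDerivAt y y' p) :
    HasFDerivAt (fun q => spectralFun (κ q) (h q) (x q) (Complex.exp (y q)))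
      (dPhiX (κ p) (h p) (x p) (Complex.exp (y p)) • x'
        + dPhiY (κ p) (h p) (x p) (Complex.exp (y p)) • y'
        + ∑ i, dPhiCas (x p) (Complex.exp (y p)) i • κ' i
        + ∑ i, dPhiHam (x p) (Complex.exp (y p)) i • h' i) p := by
  have hn := hy.fun_neg.cexp
  simp only [spectralFun_exp]
  refine (((((hx.pow 4).sub hy.cexp).add (((((hκ 0).mul (hx.pow 3)).neg.add
    ((hh 0).mul (hx.pow 2))).sub ((hh 1).mul hx)).add (hh 2))).add
    (((((hκ 1).mul hx).add (hh 3)).sub ((hκ 2).mul (hx.pow 2))).mul hn)).add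
    ((hκ 3).mul (hn.pow 2))).congr_fderiv ?_
  ext v
  simp only [dPhiX, dPhiY, dPhiCas, dPhiHam, Fin.sum_univ_four, Complex.exp_neg, Pi.sub_apply,
    Pi.add_apply, Pi.mul_apply, _root_.add_apply, _root_.sub_apply, _root_.smul_apply,
    _root_.neg_apply, smul_eq_mul, nsmul_eq_mul, cons_val, Fin.isValue, Nat.add_one_sub_one,
    Nat.cast_ofNat]
  field_simp [Complex.exp_ne_zero (y p)]
  ring

theorem differentiable_hams_apply (i : Fin 4) : Differentiable ℂ fun p => hams p i := by
  fin_cases i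
  exacts [differentiable_H1, differentiable_H2, differentiable_H3, differentiable_K1]

theorem IsBranch.differential_relation (h : IsBranch V lam mu) (hm : m ∈ V) (i : Fin 4) :
    dPhiX (casimirs m) (hams m) (lam i m) (Complex.exp (mu i m)) • grad (lam i) m
      + dPhiY (casimirs m) (hams m) (lam i m) (Complex.exp (mu i m)) • grad (mu i) m
      + ∑ j, dPhiCas (lam i m) (Complex.exp (mu i m)) j • grad (fun p => casimirs p j) m
      + ∑ j, dPhiHam (lam i m) (Complex.exp (mu i m)) j • grad (fun p => hams p j) m = 0 := by
  have hnhds := h.isOpen.mem_nhds hm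
  have hR := hasFDerivAt_spectralFun
    (fun i => (differentiable_casimirs_apply i m).hasFDerivAt)
    (fun i => (differentiable_hams_apply i m).hasFDerivAt)
    ((h.lam_holo i).differentiableAt hnhds).hasFDerivAt
    ((h.mu_holo i).differentiableAt hnhds).hasFDerivAt
  have hzero := hR.unique ((hasFDerivAt_const (0 : ℂ) m).congr_of_eventuallyEq
    (Filter.eventuallyEq_of_mem hnhds fun p hp => h.spectralFun_eq_zero hp i))
  simpa only [map_add, map_sum, map_smul, map_zero, grad] using congrArg covec.symm hzero

theorem IsBranch.dPhi_ne_zero (h : IsBranch V lam mu) (hm : m ∈ V) (hr : m ∈ regularSet)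
    (i : Fin 4) : dPhiX (casimirs m) (hams m) (lam i m) (Complex.exp (mu i m)) ≠ 0 ∨
      dPhiY (casimirs m) (hams m) (lam i m) (Complex.exp (mu i m)) ≠ 0 := by
  by_contra! hc
  have hrel := h.differential_relation hm i
  rw [hc.1, hc.2, zero_smul, zero_smul, zero_add, zero_add] at hrel
  have h₀ := Fintype.linearIndependent_iff.1 (linearIndependent_gradients_iff.2 hr.2.2)
    (Sum.elim (dPhiCas (lam i m) (Complex.exp (mu i m))) (dPhiHam (lam i m) (Complex.exp (mu i m))))
    (by rw [Fintype.sum_sum_type]; exact hrel) (Sum.inr 2)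
  exact one_ne_zero h₀

theorem IsBranch.differential_relation_leafTangent (h : IsBranch V lam mu) (hm : m ∈ V)
    (v : leafTangent m) (i : Fin 4) :
    dPhiX (casimirs m) (hams m) (lam i m) (Complex.exp (mu i m))
          * coordMap lam mu m v (Sum.inl i)
        + dPhiY (casimirs m) (hams m) (lam i m) (Complex.exp (mu i m))
          * coordMap lam mu m v (Sum.inr i)
        + ∑ j, dPhiHam (lam i m) (Complex.exp (mu i m)) j
          * (grad (fun p => hams p j) m ⬝ᵥ (v : Phase)) = 0 := by
  have hrel := congrArg (· ⬝ᵥ (v : Phase)) (h.differential_relation hm i)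
  simpa only [add_dotProduct, sum_dotProduct, smul_dotProduct, smul_eq_mul, zero_dotProduct,
    mem_leafTangent.1 v.2, mul_zero, Finset.sum_const_zero, add_zero, coordMap_apply, Sum.elim_inl,
    Sum.elim_inr] using hrel

/-- A relation between the rows would be a relation between the differentials of the coordinates
`(λ, μ)` on the leaf. -/
theorem IsBranch.det_dPhiHam_ne_zero (h : IsBranch V lam mu) (hm : m ∈ V) (hr : m ∈ regularSet) :
    (Matrix.of fun i j : Fin 4 => dPhiHam (lam i m) (Complex.exp (mu i m)) j).det ≠ 0 := by
  intro hdet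
  obtain ⟨w, hw0, hw⟩ := exists_vecMul_eq_zero_iff.2 hdet
  have hrows : ∀ j, ∑ i, w i * dPhiHam (lam i m) (Complex.exp (mu i m)) j = 0 := congrFun hw
  have hcoord : ∀ v : leafTangent m,
      ∑ i, w i * (dPhiX (casimirs m) (hams m) (lam i m) (Complex.exp (mu i m))
          * coordMap lam mu m v (Sum.inl i)
        + dPhiY (casimirs m) (hams m) (lam i m) (Complex.exp (mu i m))
          * coordMap lam mu m v (Sum.inr i)) = 0 := by
    intro v
    simp only [eq_neg_of_add_eq_zero_left (h.differential_relation_leafTangent hm v _), mul_neg,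
      Finset.sum_neg_distrib, Finset.mul_sum]
    rw [Finset.sum_comm]
    simp only [← mul_assoc, ← Finset.sum_mul, hrows, zero_mul, Finset.sum_const_zero, neg_zero]
  refine hw0 (funext fun i => ?_)
  have hsurj := (h.bijective_coordMap hm hr).2
  obtain ⟨v, hv⟩ := hsurj (Pi.single (Sum.inl i) 1)
  obtain ⟨v', hv'⟩ := hsurj (Pi.single (Sum.inr i) 1)
  have hx := hv ▸ hcoord v
  have hy := hv' ▸ hcoord v'
  simp only [Pi.single_apply, Sum.inl.injEq, Sum.inr.injEq, reduceCtorEq, if_false, mul_zero,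
    mul_ite, mul_one, zero_add, add_zero, Finset.sum_ite_eq', Finset.mem_univ, if_true] at hx hy
  rcases h.dPhi_ne_zero hm hr i with hne | hne
  · exact (mul_eq_zero.1 hx).resolve_right hne
  · exact (mul_eq_zero.1 hy).resolve_right hne

theorem hasDerivAt_spectralFun_left (κ h : Fin 4 → ℂ) (x y : ℂ) :
    HasDerivAt (fun s => spectralFun κ h s (Complex.exp y)) (dPhiX κ h x (Complex.exp y)) x := by
  simpa using (hasFDerivAt_spectralFun (fun i => hasFDerivAt_const (κ i) x)
    (fun i => hasFDerivAt_const (h i) x) (hasFDerivAt_id x) (hasFDerivAt_const y x)).hasDerivAt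

theorem hasDerivAt_spectralFun_right (κ h : Fin 4 → ℂ) (x y : ℂ) :
    HasDerivAt (fun s => spectralFun κ h x (Complex.exp s)) (dPhiY κ h x (Complex.exp y)) y := by
  simpa using (hasFDerivAt_spectralFun (fun i => hasFDerivAt_const (κ i) y)
    (fun i => hasFDerivAt_const (h i) y) (hasFDerivAt_const x y) (hasFDerivAt_id y)).hasDerivAt

theorem fderiv_spectralFun_single (κ h : Fin 4 → ℂ) (x y : ℂ) (j : Fin 4) :
    fderiv ℂ (fun h => spectralFun κ h x (Complex.exp y)) h (Pi.single j 1)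
      = dPhiHam x (Complex.exp y) j := by
  rw [(hasFDerivAt_spectralFun (fun i => hasFDerivAt_const (κ i) h)
    (fun i => hasFDerivAt_apply i h) (hasFDerivAt_const x h) (hasFDerivAt_const y h)).fderiv]
  simp [Pi.single_apply]

theorem differentiable_spectralFun (κ : Fin 4 → ℂ) : Differentiable ℂ
    fun p : ℂ × ℂ × (Fin 4 → ℂ) => spectralFun κ p.2.2 p.1 (Complex.exp p.2.1) := by
  simp only [spectralFun_exp]
  fun_prop

theorem IsBranch.isSeparatedBy (h : IsBranch V lam mu) (κ : Fin 4 → ℂ) :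
    IsSeparatedBy (V ∩ leaf κ ∩ regularSet) lam mu hams
      (fun _ x y h => spectralFun κ h x (Complex.exp y)) where
  holo _ := differentiable_spectralFun κ
  relation := by
    rintro m ⟨⟨hm, rfl⟩, -⟩ i
    exact h.spectralFun_eq_zero hm i
  effective := by
    rintro m ⟨⟨hm, rfl⟩, hr⟩ i
    rw [(hasDerivAt_spectralFun_left _ _ _ _).deriv, (hasDerivAt_spectralFun_right _ _ _ _).deriv]
    exact h.dPhi_ne_zero hm hr i
  solvable := by
    rintro m ⟨⟨hm, rfl⟩, hr⟩
    simp only [fderiv_spectralFun_single]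
    exact h.det_dPhiHam_ne_zero hm hr

theorem IsBranch.det_lax_eq_zero (h : IsBranch V lam mu) (hm : m ∈ V) (i : Fin 4) {ν : ℂ}
    (hν : ν ^ 4 = Complex.exp (mu i m)) :
    (lam i m • (1 : Matrix (Fin 4) (Fin 4) ℂ) - lax m ν).det = 0 := by
  have hν₀ : ν ≠ 0 := fun h₀ =>
    Complex.exp_ne_zero (mu i m) (by rw [← hν, h₀, zero_pow four_ne_zero])
  rw [det_lax m _ ν hν₀, hν]
  exact h.spectralFun_eq_zero hm i

end Separation

/-! ### Existence of charts -/

section Charts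

open Filter Topology

theorem exists_contDiffAt_root {E : Type*} [NormedAddCommGroup E] [NormedSpace ℂ E]
    [CompleteSpace E] {f : E × ℂ → ℂ} {m : E} {z d : ℂ} (hf : ContDiffAt ℂ 1 f (m, z))
    (hz : f (m, z) = 0) (hd : HasDerivAt (fun x => f (m, x)) d z) (hd₀ : d ≠ 0) :
    ∃ l : E → ℂ, ContDiffAt ℂ 1 l m ∧ l m = z ∧ ∀ᶠ p in 𝓝 m, f (p, l p) = 0 := by
  have hinr : fderiv ℂ f (m, z) ∘L .inr ℂ E ℂ
      = ((ContinuousLinearEquiv.unitsEquivAut ℂ (Units.mk0 d hd₀) : ℂ ≃L[ℂ] ℂ) : ℂ →L[ℂ] ℂ) := by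
    rw [((hf.differentiableAt one_ne_zero).hasFDerivAt.comp z
      (hasFDerivAt_prodMk_right m z)).unique hd.hasFDerivAt]
    ext
    simp
  have hinv : (fderiv ℂ f (m, z) ∘L .inr ℂ E ℂ).IsInvertible := ⟨_, hinr.symm⟩
  refine ⟨hf.implicitFunction one_ne_zero hinv, hf.contDiffAt_implicitFunction one_ne_zero hinv,
    hf.implicitFunction_apply_self one_ne_zero hinv, ?_⟩
  exact (hf.eventually_apply_implicitFunction one_ne_zero hinv).mono fun p hp => hp.trans hz

theorem exists_contDiffAt_log {E : Type*} [NormedAddCommGroup E] [NormedSpace ℂ E] {f : E → ℂ}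
    {m : E} (hf : ContDiffAt ℂ 1 f m) (h₀ : f m ≠ 0) :
    ∃ u : E → ℂ, ContDiffAt ℂ 1 u m ∧ ∀ᶠ p in 𝓝 m, Complex.exp (u p) = f p := by
  refine ⟨fun p => Complex.log (f p / f m) + Complex.log (f m), ?_, ?_⟩
  · refine ContDiffAt.add (ContDiffAt.comp m (Complex.contDiffAt_log ?_) (hf.div_const _))
      contDiffAt_const
    rw [div_self h₀]
    exact Complex.one_mem_slitPlane
  · filter_upwards [hf.continuousAt.eventually_ne h₀] with p hp
    rw [Complex.exp_add, Complex.exp_log (div_ne_zero hp h₀), Complex.exp_log h₀,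
      div_mul_cancel₀ _ h₀]

theorem eventually_injective {ι X Y : Type*} [Finite ι] [TopologicalSpace X] [TopologicalSpace Y]
    [T2Space Y] {f : ι → X → Y} {m : X} (hf : ∀ i, ContinuousAt (f i) m)
    (hm : Function.Injective fun i => f i m) : ∀ᶠ p in 𝓝 m, Function.Injective fun i => f i p := by
  have h : ∀ i j, ∀ᶠ p in 𝓝 m, f i p = f j p → i = j := fun i j => by
    rcases eq_or_ne i j with rfl | hij
    · exact .of_forall fun _ _ => rfl
    · exact (((hf i).ne_iff_eventually_ne (hf j)).1 (hm.ne hij)).mono fun p hp h => (hp h).elim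
  exact (eventually_all.2 fun i => eventually_all.2 (h i)).mono fun p hp i j => hp i j

theorem injOn_and_isOpen_image_fiber {X Y Z : Type*} [TopologicalSpace X] [TopologicalSpace Y]
    [TopologicalSpace Z] (Θ : OpenPartialHomeomorph X (Y × Z)) {V : Set X} (hV : IsOpen V)
    (hVΘ : V ⊆ Θ.source) (c : Z) :
    Set.InjOn (fun p => (Θ p).1) (V ∩ {p | (Θ p).2 = c}) ∧
      IsOpen ((fun p => (Θ p).1) '' (V ∩ {p | (Θ p).2 = c})) := by
  refine ⟨fun p hp q hq hpq => Θ.injOn (hVΘ hp.1) (hVΘ hq.1)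
    (Prod.ext hpq (hp.2.trans hq.2.symm)), ?_⟩
  convert (Θ.isOpen_image_of_subset_source hV hVΘ).preimage
    (Continuous.prodMk_left c : Continuous fun y : Y => (y, c)) using 1
  ext y
  constructor
  · rintro ⟨p, ⟨hp, hc⟩, rfl⟩
    exact ⟨p, hp, Prod.ext rfl hc⟩
  · rintro ⟨p, hp, hy⟩
    exact ⟨p, ⟨hp, congrArg Prod.snd hy⟩, congrArg Prod.fst hy⟩

@[fun_prop]
theorem contDiff_bc (i : Fin 4) : ContDiff ℂ 1 fun m => bc m i := contDiff_apply ℂ ℂ (Sum.inl i)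

@[fun_prop]
theorem contDiff_ac (i : Fin 4) : ContDiff ℂ 1 fun m => ac m i :=
  contDiff_apply ℂ ℂ (Sum.inr (Sum.inl i))

@[fun_prop]
theorem contDiff_cc (i : Fin 4) : ContDiff ℂ 1 fun m => cc m i :=
  contDiff_apply ℂ ℂ (Sum.inr (Sum.inr i))

theorem contDiff_casimirs_apply (i : Fin 4) : ContDiff ℂ 1 fun m => casimirs m i := by
  fin_cases i
  · change ContDiff ℂ 1 fun m => H0 m
    unfold H0
    fun_prop
  · change ContDiff ℂ 1 fun m => K0 m
    unfold K0
    fun_prop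
  · change ContDiff ℂ 1 fun m => J1 m
    unfold J1
    fun_prop
  · change ContDiff ℂ 1 fun m => J2 m
    unfold J2
    fun_prop

theorem contDiff_hams_apply (i : Fin 4) : ContDiff ℂ 1 fun m => hams m i := by
  fin_cases i
  · change ContDiff ℂ 1 fun m => H1 m
    unfold H1
    fun_prop
  · change ContDiff ℂ 1 fun m => H2 m
    unfold H2
    fun_prop
  · change ContDiff ℂ 1 fun m => H3 m
    unfold H3
    fun_prop
  · change ContDiff ℂ 1 fun m => K1 m
    unfold K1
    fun_prop

theorem contDiff_shift : ContDiff ℂ 1 fun q : Phase × ℂ => shift q.2 q.1 := by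
  unfold shift
  fun_prop

theorem contDiff_calG (i j : Fin 2) : ContDiff ℂ 1 fun q : Phase × ℂ => calG q.1 q.2 i j := by
  have h : ∀ f : Phase → ℂ, ContDiff ℂ 1 f → ContDiff ℂ 1 fun q : Phase × ℂ => f (shift q.2 q.1) :=
    fun f hf => hf.comp contDiff_shift
  fin_cases i <;> fin_cases j <;>
    simp only [Fin.zero_eta, Fin.mk_one, Fin.isValue, calG_apply_zero, calG_apply_one,
      lieZ_H3_zero, lieZ_H3_one, lieZ_K1_zero, lieZ_K1_one]
  · exact h (fun n => -(bc n 0 * bc n 1 * bc n 2 + bc n 0 * ac n 1 + bc n 2 * ac n 0 + cc n 0))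
      (by fun_prop)
  · exact h (fun n => bc n 1 * bc n 2 + ac n 1) (by fun_prop)
  · exact h (fun n => bc n 1 * cc n 0 * cc n 2 - ac n 0 * ac n 1 * cc n 2) (by fun_prop)
  · exact h (fun n => bc n 1 * ac n 2 * cc n 0 + bc n 2 * ac n 0 * cc n 1
      - ac n 0 * ac n 1 * ac n 2 + cc n 0 * cc n 1) (by fun_prop)

theorem continuous_det_redG : Continuous fun m => (redG m).det := by
  simp only [det_redG]
  fun_prop

theorem eventually_linearIndependent_fderiv {m : Phase}
    (hm : LinearIndependent ℂ (Sum.elim (fun i : Fin 4 => fderiv ℂ (fun x => casimirs x i) m)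
      (fun i : Fin 4 => fderiv ℂ (fun x => hams x i) m))) :
    ∀ᶠ p in 𝓝 m, LinearIndependent ℂ
      (Sum.elim (fun i : Fin 4 => fderiv ℂ (fun x => casimirs x i) p)
        (fun i : Fin 4 => fderiv ℂ (fun x => hams x i) p)) := by
  have hc : Continuous fun p => (Sum.elim (fun i : Fin 4 => fderiv ℂ (fun x => casimirs x i) p)
      (fun i : Fin 4 => fderiv ℂ (fun x => hams x i) p)) := continuous_pi fun s => by
    rcases s with i | i
    exacts [(contDiff_casimirs_apply i).continuous_fderiv one_ne_zero,
      (contDiff_hams_apply i).continuous_fderiv one_ne_zero]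
  exact (isOpen_setOfPred_linearIndependent.preimage hc).mem_nhds hm

theorem exists_contDiffAt_lam {m : Phase} {z : Fin 4 → ℂ} (hG : (redG m).det ≠ 0)
    (hz : Function.Injective z) (hroot : ∀ i, (calG m (z i)).det = 0) (i : Fin 4) :
    ∃ l : Phase → ℂ, ContDiffAt ℂ 1 l m ∧ l m = z i ∧ ∀ᶠ p in 𝓝 m, (calG p (l p)).det = 0 := by
  have hdet : ContDiff ℂ 1 fun q : Phase × ℂ => (calG q.1 q.2).det := by
    simp only [det_fin_two]
    exact ((contDiff_calG 0 0).mul (contDiff_calG 1 1)).sub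
      ((contDiff_calG 0 1).mul (contDiff_calG 1 0))
  refine exists_contDiffAt_root hdet.contDiffAt (hroot i) ?_
    (eval_derivative_detPoly_ne_zero hG hz hroot i)
  simpa only [← eval_detPoly] using (detPoly m).hasDerivAt (z i)

theorem exists_contDiffAt_mu {m : Phase} {l : Phase → ℂ} (hl : ContDiffAt ℂ 1 l m)
    (h₀₁ : calG m (l m) 0 1 ≠ 0) (h₁₁ : calG m (l m) 1 1 ≠ 0) :
    ∃ u : Phase → ℂ, ContDiffAt ℂ 1 u m ∧
      ∀ᶠ p in 𝓝 m, calG p (l p) 0 1 ≠ 0 ∧ Complex.exp (u p) = rho p (l p) := by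
  have h : ∀ i j, ContDiffAt ℂ 1 (fun p => calG p (l p) i j) m := fun i j =>
    ContDiffAt.comp m (g := fun q : Phase × ℂ => calG q.1 q.2 i j) (f := fun p => (p, l p))
      (contDiff_calG i j).contDiffAt (contDiffAt_id.prodMk hl)
  have hρ : ContDiffAt ℂ 1 (fun p => rho p (l p)) m := by
    simp only [rho]
    exact (h 1 1).neg.div (h 0 1) h₀₁
  have hρ₀ : rho m (l m) ≠ 0 := by
    rw [rho]
    exact div_ne_zero (neg_ne_zero.2 h₁₁) h₀₁
  obtain ⟨u, hu, hexp⟩ := exists_contDiffAt_log hρ hρ₀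
  exact ⟨u, hu, ((h 0 1).continuousAt.eventually_ne h₀₁).and hexp⟩

variable {V : Set Phase} {lam mu : Fin 4 → Phase → ℂ} {m : Phase}

theorem IsBranch.mono (h : IsBranch V lam mu) {W : Set Phase} (hW : IsOpen W) (hWV : W ⊆ V) :
    IsBranch W lam mu where
  isOpen := hW
  lam_holo i := (h.lam_holo i).mono hWV
  mu_holo i := (h.mu_holo i).mono hWV
  root p hp := h.root p (hWV hp)
  distinct p hp := h.distinct p (hWV hp)
  denom_ne p hp := h.denom_ne p (hWV hp)
  exp_mu p hp := h.exp_mu p (hWV hp)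

theorem IsBranch.calG_one_one_ne_zero (h : IsBranch V lam mu) (hm : m ∈ V) (i : Fin 4) :
    calG m (lam i m) 1 1 ≠ 0 := fun h₀ => Complex.exp_ne_zero (mu i m) <| by
  rw [h.exp_mu m hm i, rho, h₀, neg_zero, zero_div]

theorem exists_isBranch (hm : m ∈ regularSet) :
    ∃ (V : Set Phase) (lam mu : Fin 4 → Phase → ℂ), m ∈ V ∧ V ⊆ regularSet ∧ IsBranch V lam mu ∧
      ∀ i, ContDiffAt ℂ 1 (lam i) m ∧ ContDiffAt ℂ 1 (mu i) m := by
  obtain ⟨hG, ⟨z, hz, hroot⟩, hli⟩ := hm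
  choose lam hlam hlamz hdet using exists_contDiffAt_lam hG hz fun i => (hroot i).1
  have hne : ∀ i, calG m (lam i m) 0 1 ≠ 0 ∧ calG m (lam i m) 1 1 ≠ 0 := fun i =>
    hlamz i ▸ (hroot i).2
  choose mu hmu hrho using fun i => exists_contDiffAt_mu (hlam i) (hne i).1 (hne i).2
  have hinj : Function.Injective fun i => lam i m := by simpa only [hlamz] using hz
  have hev := (eventually_all.2 fun i => (((hlam i).eventually (by simp)).and
      ((hmu i).eventually (by simp))).and ((hdet i).and (hrho i))).and
    ((eventually_injective (fun i => (hlam i).continuousAt) hinj).and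
    ((continuous_det_redG.continuousAt.eventually_ne hG).and
      (eventually_linearIndependent_fderiv hli)))
  obtain ⟨V, hV, hVo, hmV⟩ := eventually_nhds_iff.1 hev
  have hB : IsBranch V lam mu :=
    { isOpen := hVo
      lam_holo := fun i p hp =>
        (((hV p hp).1 i).1.1.differentiableAt one_ne_zero).differentiableWithinAt
      mu_holo := fun i p hp =>
        (((hV p hp).1 i).1.2.differentiableAt one_ne_zero).differentiableWithinAt
      root := fun p hp i => ((hV p hp).1 i).2.1
      distinct := fun p hp => (hV p hp).2.1
      denom_ne := fun p hp i => ((hV p hp).1 i).2.2.1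
      exp_mu := fun p hp i => ((hV p hp).1 i).2.2.2 }
  refine ⟨V, lam, mu, hmV, fun p hp => ⟨(hV p hp).2.2.1, ⟨fun i => lam i p, hB.distinct p hp,
    fun i => ⟨hB.root p hp i, hB.denom_ne p hp i, hB.calG_one_one_ne_zero hp i⟩⟩,
    (hV p hp).2.2.2⟩, hB, fun i => ⟨hlam i, hmu i⟩⟩

theorem IsBranch.exists_openPartialHomeomorph (h : IsBranch V lam mu) (hm : m ∈ V)
    (hr : m ∈ regularSet) (hlam : ∀ i, ContDiffAt ℂ 1 (lam i) m)
    (hmu : ∀ i, ContDiffAt ℂ 1 (mu i) m) :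
    ∃ Θ : OpenPartialHomeomorph Phase (((Fin 4 → ℂ) × (Fin 4 → ℂ)) × (Fin 4 → ℂ)),
      m ∈ Θ.source ∧ ∀ p, Θ p = ((fun i => lam i p, fun i => mu i p), casimirs p) := by
  have hΨ := ((hasStrictFDerivAt_pi.2 fun i => (hlam i).hasStrictFDerivAt one_ne_zero).prodMk
    (hasStrictFDerivAt_pi.2 fun i => (hmu i).hasStrictFDerivAt one_ne_zero)).prodMk
    ((contDiff_pi.2 contDiff_casimirs_apply).contDiffAt.hasStrictFDerivAt (x := m) one_ne_zero)
  set T := ((ContinuousLinearMap.pi fun i => fderiv ℂ (lam i) m).prod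
    (ContinuousLinearMap.pi fun i => fderiv ℂ (mu i) m)).prod (fderiv ℂ casimirs m)
  have hinj : Function.Injective T.toLinearMap := by
    refine (injective_iff_map_eq_zero _).2 fun v hv => ?_
    have hv : T v = 0 := hv
    have hvt : v ∈ leafTangent m := congrArg Prod.snd hv
    have hcoord : coordMap lam mu m ⟨v, hvt⟩ = 0 := funext fun s => by
      rcases s with i | i
      exacts [congrFun (congrArg (·.1.1) hv) i, congrFun (congrArg (·.1.2) hv) i]
    exact congrArg Subtype.val ((h.bijective_coordMap hm hr).1 (hcoord.trans (map_zero _).symm))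
  let e := (LinearMap.linearEquivOfInjective T.toLinearMap hinj
    (by simp)).toContinuousLinearEquiv
  have he : HasStrictFDerivAt (fun p => ((fun i => lam i p, fun i => mu i p), casimirs p))
    (e : Phase →L[ℂ] _) m := hΨ
  exact ⟨he.toOpenPartialHomeomorph _, he.mem_toOpenPartialHomeomorph_source, fun p => rfl⟩

theorem exists_chart (hm : m ∈ regularSet) :
    ∃ (V : Set Phase) (lam mu : Fin 4 → Phase → ℂ), m ∈ V ∧ V ⊆ regularSet ∧ IsBranch V lam mu ∧
      ∀ κ : Fin 4 → ℂ,
        Set.InjOn (fun p => ((fun i => lam i p, fun i => mu i p) : (Fin 4 → ℂ) × (Fin 4 → ℂ)))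
          (V ∩ leaf κ) ∧
        IsOpen ((fun p => ((fun i => lam i p, fun i => mu i p) : (Fin 4 → ℂ) × (Fin 4 → ℂ))) ''
          (V ∩ leaf κ)) := by
  obtain ⟨V, lam, mu, hmV, hVr, hB, hd⟩ := exists_isBranch hm
  obtain ⟨Θ, hmΘ, hΘ⟩ := hB.exists_openPartialHomeomorph hmV hm (fun i => (hd i).1)
    fun i => (hd i).2
  have hV : IsOpen (V ∩ Θ.source) := hB.isOpen.inter Θ.open_source
  refine ⟨V ∩ Θ.source, lam, mu, ⟨hmV, hmΘ⟩, Set.inter_subset_left.trans hVr,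
    hB.mono hV Set.inter_subset_left, fun κ => ?_⟩
  simpa only [hΘ, leaf] using injOn_and_isOpen_image_fiber Θ hV Set.inter_subset_right κ

end Charts

/-! ### Polynomial functions and resultants -/

section PolynomialFunctions

variable {σ τ ι : Type*}

/-- `F` is given by a polynomial in the coordinates. -/
@[fun_prop]
def IsPoly (F : (σ → ℂ) → ℂ) : Prop :=
  ∃ p : MvPolynomial σ ℂ, ∀ x, F x = MvPolynomial.eval x p

namespace IsPoly

variable {F G : (σ → ℂ) → ℂ}

@[fun_prop]
theorem const (c : ℂ) : IsPoly fun _ : σ → ℂ => c := ⟨MvPolynomial.C c, by simp⟩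

@[fun_prop]
theorem apply (i : σ) : IsPoly fun x : σ → ℂ => x i := ⟨MvPolynomial.X i, by simp⟩

@[fun_prop]
theorem add (hF : IsPoly F) (hG : IsPoly G) : IsPoly fun x => F x + G x := by
  obtain ⟨p, hp⟩ := hF
  obtain ⟨q, hq⟩ := hG
  exact ⟨p + q, fun x => by simp only [map_add, hp, hq]⟩

@[fun_prop]
theorem sub (hF : IsPoly F) (hG : IsPoly G) : IsPoly fun x => F x - G x := by
  obtain ⟨p, hp⟩ := hF
  obtain ⟨q, hq⟩ := hG
  exact ⟨p - q, fun x => by simp only [map_sub, hp, hq]⟩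

@[fun_prop]
theorem neg (hF : IsPoly F) : IsPoly fun x => -F x := by
  obtain ⟨p, hp⟩ := hF
  exact ⟨-p, fun x => by simp only [map_neg, hp]⟩

@[fun_prop]
theorem mul (hF : IsPoly F) (hG : IsPoly G) : IsPoly fun x => F x * G x := by
  obtain ⟨p, hp⟩ := hF
  obtain ⟨q, hq⟩ := hG
  exact ⟨p * q, fun x => by simp only [map_mul, hp, hq]⟩

theorem dotProduct_const [Fintype ι] {u : (σ → ℂ) → ι → ℂ} (hu : ∀ i, IsPoly fun x => u x i)
    (v : ι → ℂ) : IsPoly fun x => u x ⬝ᵥ v := by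
  choose p hp using hu
  refine ⟨∑ i, p i * MvPolynomial.C (v i), fun x => ?_⟩
  simp only [dotProduct, hp, map_sum, map_mul, MvPolynomial.eval_C]

theorem det [Fintype ι] [DecidableEq ι] {M : (σ → ℂ) → Matrix ι ι ℂ}
    (hM : ∀ i j, IsPoly fun x => M x i j) : IsPoly fun x => (M x).det := by
  choose p hp using hM
  refine ⟨(Matrix.of p).det, fun x => ?_⟩
  rw [RingHom.map_det]
  exact congrArg Matrix.det (Matrix.ext fun i j => hp i j x)

theorem comp {F : (τ → ℂ) → ℂ} (hF : IsPoly F) {φ : (σ → ℂ) → τ → ℂ}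
    (hφ : ∀ t, IsPoly fun x => φ x t) : IsPoly fun x => F (φ x) := by
  obtain ⟨p, hp⟩ := hF
  choose q hq using hφ
  refine ⟨MvPolynomial.bind₁ q p, fun x => ?_⟩
  rw [MvPolynomial.eval, MvPolynomial.eval₂Hom_bind₁]
  refine (hp _).trans ?_
  exact congrArg (fun y => MvPolynomial.eval₂Hom (RingHom.id ℂ) y p) (funext fun t => hq t x)

theorem differentiable [Finite σ] (hF : IsPoly F) : Differentiable ℂ F := by
  have := Fintype.ofFinite σ
  obtain ⟨p, hp⟩ := hF
  rw [funext hp]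
  exact fun x => (AnalyticOnNhd.eval_mvPolynomial p x (Set.mem_univ x)).differentiableAt

end IsPoly

open Polynomial

/-- The coefficients of the polynomial `p x` are given by polynomials in the coordinates of `x`. -/
@[fun_prop]
def HasPolyCoeffs (p : (σ → ℂ) → ℂ[X]) : Prop :=
  ∃ q : (MvPolynomial σ ℂ)[X], ∀ x, p x = q.map (MvPolynomial.eval x)

namespace HasPolyCoeffs

variable {p q : (σ → ℂ) → ℂ[X]}

@[fun_prop]
theorem C {F : (σ → ℂ) → ℂ} (hF : IsPoly F) : HasPolyCoeffs fun x => Polynomial.C (F x) := by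
  obtain ⟨P, hP⟩ := hF
  exact ⟨Polynomial.C P, fun x => by simp only [map_C, hP]⟩

@[fun_prop]
theorem X : HasPolyCoeffs fun _ : σ → ℂ => Polynomial.X := ⟨Polynomial.X, fun _ => (map_X _).symm⟩

@[fun_prop]
theorem add (hp : HasPolyCoeffs p) (hq : HasPolyCoeffs q) : HasPolyCoeffs fun x => p x + q x := by
  obtain ⟨P, hP⟩ := hp
  obtain ⟨Q, hQ⟩ := hq
  exact ⟨P + Q, fun x => by simp only [Polynomial.map_add, hP, hQ]⟩

@[fun_prop]
theorem sub (hp : HasPolyCoeffs p) (hq : HasPolyCoeffs q) : HasPolyCoeffs fun x => p x - q x := by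
  obtain ⟨P, hP⟩ := hp
  obtain ⟨Q, hQ⟩ := hq
  exact ⟨P - Q, fun x => by simp only [Polynomial.map_sub, hP, hQ]⟩

@[fun_prop]
theorem neg (hp : HasPolyCoeffs p) : HasPolyCoeffs fun x => -p x := by
  obtain ⟨P, hP⟩ := hp
  exact ⟨-P, fun x => by simp only [Polynomial.map_neg, hP]⟩

@[fun_prop]
theorem mul (hp : HasPolyCoeffs p) (hq : HasPolyCoeffs q) : HasPolyCoeffs fun x => p x * q x := by
  obtain ⟨P, hP⟩ := hp
  obtain ⟨Q, hQ⟩ := hq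
  exact ⟨P * Q, fun x => by simp only [Polynomial.map_mul, hP, hQ]⟩

theorem derivative (hp : HasPolyCoeffs p) : HasPolyCoeffs fun x => (p x).derivative := by
  obtain ⟨P, hP⟩ := hp
  exact ⟨P.derivative, fun x => by simp only [hP, derivative_map]⟩

theorem isPoly_resultant (hp : HasPolyCoeffs p) (hq : HasPolyCoeffs q) (m n : ℕ) :
    IsPoly fun x => (p x).resultant (q x) m n := by
  obtain ⟨P, hP⟩ := hp
  obtain ⟨Q, hQ⟩ := hq
  exact ⟨P.resultant Q m n, fun x =>
    (congrArg₂ (fun f g => f.resultant g m n) (hP x) (hQ x)).trans (resultant_map_map ..)⟩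

end HasPolyCoeffs

theorem isCoprime_of_resultant_ne_zero {K : Type*} [Field K] {f g : K[X]} {m n : ℕ}
    (hf : f.natDegree ≤ m) (hg : g.natDegree ≤ n) (hmn : m ≠ 0 ∨ n ≠ 0)
    (h : f.resultant g m n ≠ 0) : IsCoprime f g := by
  obtain ⟨p, q, -, -, hpq⟩ := exists_mul_add_mul_eq_C_resultant f g hf hg hmn
  have hC : Polynomial.C (f.resultant g m n)⁻¹ * Polynomial.C (f.resultant g m n) = 1 := by
    rw [← C_mul, inv_mul_cancel₀ h, C_1]
  exact ⟨Polynomial.C (f.resultant g m n)⁻¹ * p, Polynomial.C (f.resultant g m n)⁻¹ * q, by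
    linear_combination Polynomial.C (f.resultant g m n)⁻¹ * hpq + hC⟩

theorem exists_injective_isRoot {K : Type*} [Field K] [IsAlgClosed K] {p : K[X]}
    (hp : p.Separable) {n : ℕ} (hn : p.natDegree = n) :
    ∃ z : Fin n → K, Function.Injective z ∧ ∀ i, p.IsRoot (z i) := by
  classical
  have hcard : p.roots.toFinset.card = n := by
    rw [Multiset.toFinset_card_of_nodup (nodup_roots hp), ← hn]
    exact splits_iff_card_roots.1 (IsAlgClosed.splits p)
  let e := p.roots.toFinset.equivFinOfCardEq hcard
  exact ⟨fun i => e.symm i, Subtype.val_injective.comp e.symm.injective, fun i =>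
    isRoot_of_mem_roots (Multiset.mem_toFinset.1 (e.symm i).2)⟩

end PolynomialFunctions

/-! ### A polynomial vanishing off the regular set -/

section Regularizer

open Polynomial

@[fun_prop]
theorem isPoly_bc (i : Fin 4) : IsPoly fun m => bc m i := IsPoly.apply _

@[fun_prop]
theorem isPoly_ac (i : Fin 4) : IsPoly fun m => ac m i := IsPoly.apply _

@[fun_prop]
theorem isPoly_cc (i : Fin 4) : IsPoly fun m => cc m i := IsPoly.apply _

theorem isPoly_vec {σ : Type*} {b a c : (σ → ℂ) → Fin 4 → ℂ} (hb : ∀ i, IsPoly fun x => b x i)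
    (ha : ∀ i, IsPoly fun x => a x i) (hc : ∀ i, IsPoly fun x => c x i) (t : Idx) :
    IsPoly fun x => vec (b x) (a x) (c x) t := by
  rcases t with i | i | i
  exacts [hb i, ha i, hc i]

theorem hasPolyCoeffs_calGPoly (i j : Fin 2) : HasPolyCoeffs fun m => calGPoly m i j := by
  fin_cases i <;> fin_cases j <;>
    simp only [calGPoly, of_apply, cons_val, Fin.zero_eta, Fin.mk_one] <;> fun_prop

theorem hasPolyCoeffs_detPoly : HasPolyCoeffs detPoly := by
  have h := hasPolyCoeffs_calGPoly
  unfold detPoly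
  simp only [det_fin_two]
  exact ((h 0 0).mul (h 1 1)).sub ((h 0 1).mul (h 1 0))

theorem gradients_eq (m : Phase) : gradients m =
    Sum.elim ![grad H0 m, grad K0 m, grad J1 m, grad J2 m]
      ![grad H1 m, grad H2 m, grad H3 m, grad K1 m] := by
  funext i
  rcases i with i | i <;> fin_cases i <;> rfl

theorem isPoly_gradients (i : Fin 4 ⊕ Fin 4) (t : Idx) : IsPoly fun m => gradients m i t := by
  simp only [gradients_eq, grad_H0, grad_H1, grad_H2, grad_H3, grad_K0, grad_K1, grad_J1, grad_J2]
  rcases i with i | i <;> fin_cases i <;>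
    exact isPoly_vec (by fun_prop) (by fun_prop) (by fun_prop) t

/-- Vectors dual to the gradients of the eight functions at the point `basePoint ![0, 0, 1, 0]`. -/
def testVec : Fin 4 ⊕ Fin 4 → Phase :=
  Sum.elim
    ![vec ![0, 1, 1, -1] 0 0, vec ![-1, 1, 0, 0] 0 0, vec ![0, 1, 0, -1] 0 ![1, 0, 0, 0],
      vec 0 0 ![-1, 0, 0, 1]]
    ![vec 0 ![1, 0, 0, 0] ![1, 0, -1, 0], vec ![0, -1, 0, 1] 0 0, vec ![1, -1, -1, 1] 0 0,
      vec 0 0 ![-1, 0, 1, 0]]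

/-- An `8 × 8` minor of the Jacobian matrix of the eight functions, in the directions `testVec`. -/
def testMatrix (m : Phase) : Matrix (Fin 4 ⊕ Fin 4) (Fin 4 ⊕ Fin 4) ℂ :=
  of fun i j => gradients m i ⬝ᵥ testVec j

theorem linearIndependent_gradients {m : Phase} (hm : (testMatrix m).det ≠ 0) :
    LinearIndependent ℂ (gradients m) := by
  rw [Fintype.linearIndependent_iff]
  intro w hw i
  have h : w ᵥ* testMatrix m = 0 := by
    ext j
    have hj := congrArg (· ⬝ᵥ testVec j) hw
    simp only [sum_dotProduct, smul_dotProduct, zero_dotProduct] at hj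
    exact hj
  exact congrFun (eq_zero_of_vecMul_eq_zero hm h) i

/-- A polynomial function vanishing off the regular set. The resultant excludes multiple roots of
`det 𝒢` and its common roots with `𝒢₁₂ 𝒢₂₂`. -/
def regularizer (m : Phase) : ℂ :=
  (redG m).det * (detPoly m).resultant
    (derivative (detPoly m) * (calGPoly m 0 1 * calGPoly m 1 1)) 4 6 * (testMatrix m).det

theorem isPoly_regularizer : IsPoly regularizer := by
  have hG : IsPoly fun m => (redG m).det := by simp only [det_redG]; fun_prop
  have hq := hasPolyCoeffs_detPoly.derivative.mul
    ((hasPolyCoeffs_calGPoly 0 1).mul (hasPolyCoeffs_calGPoly 1 1))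
  exact (hG.mul (hasPolyCoeffs_detPoly.isPoly_resultant hq 4 6)).mul <| IsPoly.det fun i j =>
    IsPoly.dotProduct_const (isPoly_gradients i) _

theorem natDegree_calGPoly_zero_one_le (m : Phase) : (calGPoly m 0 1).natDegree ≤ 2 := by
  simp only [calGPoly, of_apply, cons_val]
  compute_degree

theorem natDegree_calGPoly_one_one_le (m : Phase) : (calGPoly m 1 1).natDegree ≤ 1 := by
  simp only [calGPoly, of_apply, cons_val]
  compute_degree

theorem mem_regularSet_of_regularizer_ne_zero {m : Phase} (hm : regularizer m ≠ 0) :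
    m ∈ regularSet := by
  simp only [regularizer, mul_ne_zero_iff] at hm
  obtain ⟨⟨hG, hres⟩, ht⟩ := hm
  have hdeg : (detPoly m).natDegree = 4 :=
    natDegree_eq_of_le_of_coeff_ne_zero (natDegree_detPoly_le m)
      ((coeff_detPoly m).symm ▸ neg_ne_zero.mpr hG)
  have hq : (derivative (detPoly m) * (calGPoly m 0 1 * calGPoly m 1 1)).natDegree ≤ 6 :=
    natDegree_mul_le_of_le ((natDegree_derivative_le _).trans (by rw [hdeg])) <|
      natDegree_mul_le_of_le (natDegree_calGPoly_zero_one_le m) (natDegree_calGPoly_one_one_le m)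
  have hcop := isCoprime_of_resultant_ne_zero hdeg.le hq (by decide) hres
  rw [IsCoprime.mul_right_iff, IsCoprime.mul_right_iff] at hcop
  obtain ⟨hsep, h01, h11⟩ := hcop
  obtain ⟨z, hz, hroot⟩ := exists_injective_isRoot hsep hdeg
  have hne : ∀ i {q : ℂ[X]}, IsCoprime (detPoly m) q → q.eval (z i) ≠ 0 := fun i q h h0 =>
    h.isUnit_of_dvd' (dvd_iff_isRoot.mpr (hroot i)) (dvd_iff_isRoot.mpr h0) |>
      not_isUnit_X_sub_C _
  refine ⟨hG, ⟨z, hz, fun i => ⟨?_, ?_, ?_⟩⟩, ?_⟩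
  · rw [← eval_detPoly]
    exact hroot i
  · rw [← eval_calGPoly]
    exact hne i h01
  · rw [← eval_calGPoly]
    exact hne i h11
  · exact linearIndependent_gradients_iff.1 (linearIndependent_gradients ht)

/-- A point of the level set with `H₀ = k 0`, `K₀ = k 1`, `c₁ c₃ = k 2` and `c₂ c₄ = k 3`. -/
def basePoint (k : Fin 4 → ℂ) : Phase :=
  vec ![0, 0, 0, k 0] ![1, 0, 0, k 0 * k 2 - k 1] ![1, 1, k 2, k 3]

theorem isPoly_basePoint (t : Idx) : IsPoly fun k : Fin 4 → ℂ => basePoint k t := by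
  refine isPoly_vec (fun i => ?_) (fun i => ?_) (fun i => ?_) t <;> fin_cases i <;>
    simp only [Fin.zero_eta, Fin.mk_one, Fin.reduceFinMk, cons_val] <;> fun_prop

theorem testMatrix_basePoint : testMatrix (basePoint ![0, 0, 1, 0]) = 1 := by
  ext i j
  simp only [testMatrix, gradients_eq, of_apply, grad_H0, grad_H1, grad_H2, grad_H3, grad_K0,
    grad_K1, grad_J1, grad_J2, testVec]
  rcases i with i | i <;> rcases j with j | j <;> fin_cases i <;> fin_cases j <;>
    simp [dotProduct_phase, bc_vec, ac_vec, cc_vec, basePoint, Fin.sum_univ_four]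

theorem isCoprime_basePoint : IsCoprime (-X ^ 4 + 2 * X ^ 3 - X ^ 2 + 2 * X - 1 : ℂ[X])
    ((-4 * X ^ 3 + 6 * X ^ 2 - 2 * X + 2) * (X ^ 2 * (1 - X))) := by
  have h28 : C (1 / 28 : ℂ) * 28 = 1 := by
    rw [← map_ofNat C, ← C_mul, ← C_1]
    norm_num
  refine .mul_right ?_ (.mul_right (.pow_right ?_) ?_)
  · exact ⟨C (1 / 28) * (-4 - 34 * X + 36 * X ^ 2),
      C (1 / 28) * (12 - X + 13 * X ^ 2 - 9 * X ^ 3), by linear_combination h28⟩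
  · exact ⟨-1, -X ^ 3 + 2 * X ^ 2 - X + 2, by ring⟩
  · exact ⟨1, -X ^ 3 + X ^ 2 + 2, by ring⟩

theorem regularizer_basePoint_ne_zero : regularizer (basePoint ![0, 0, 1, 0]) ≠ 0 := by
  have hf : detPoly (basePoint ![0, 0, 1, 0]) = -X ^ 4 + 2 * X ^ 3 - X ^ 2 + 2 * X - 1 := by
    simp only [detPoly, calGPoly, basePoint, Fin.isValue, cons_val_zero, cons_val, mul_one,
      cons_val_one, sub_self, bc_vec, map_zero, zero_sub, ac_vec, mul_zero, add_zero, map_one,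
      cc_vec, sub_zero, zero_add, det_fin_two, of_apply, cons_val_fin_one]
    ring
  have hf' : derivative (detPoly (basePoint ![0, 0, 1, 0])) =
      -4 * X ^ 3 + 6 * X ^ 2 - 2 * X + 2 := by
    rw [hf]
    simp only [derivative_add, derivative_sub, derivative_neg, derivative_mul, derivative_X_pow,
      derivative_ofNat, derivative_X, derivative_one, map_natCast]
    push_cast
    ring
  have h01 : calGPoly (basePoint ![0, 0, 1, 0]) 0 1 = X ^ 2 := by
    simp only [calGPoly, basePoint, bc_vec, ac_vec, of_apply, cons_val, map_zero]
    ring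
  have h11 : calGPoly (basePoint ![0, 0, 1, 0]) 1 1 = 1 - X := by
    simp only [calGPoly, basePoint, Fin.isValue, cons_val_zero, cons_val, mul_one, cons_val_one,
      sub_self, bc_vec, map_zero, zero_sub, ac_vec, mul_zero, add_zero, map_one, cc_vec, sub_zero,
      zero_add, of_apply, cons_val_fin_one]
    ring
  have hdeg : (-X ^ 4 + 2 * X ^ 3 - X ^ 2 + 2 * X - 1 : ℂ[X]).natDegree = 4 := by
    compute_degree!
  have hdeg' : ((-4 * X ^ 3 + 6 * X ^ 2 - 2 * X + 2) * (X ^ 2 * (1 - X)) : ℂ[X]).natDegree = 6 := by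
    compute_degree!
  have hres := resultant_ne_zero _ _ isCoprime_basePoint
  rw [hdeg, hdeg'] at hres
  rw [regularizer, testMatrix_basePoint, det_one, mul_one, hf', h01, h11, hf]
  refine mul_ne_zero ?_ hres
  rw [det_redG]
  simp [basePoint, ac_vec, cc_vec]

end Regularizer

/-! ### Generic level sets of the Casimirs -/

section GenericLeaves

variable {m : Phase}

theorem linearIndependent_grad_casimirs (h2 : cc m 2 ≠ 0) (h3 : cc m 3 ≠ 0)
    (hpq : cc m 0 * cc m 2 ≠ cc m 1 * cc m 3) :
    LinearIndependent ℂ fun i => grad (fun p => casimirs p i) m := by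
  have hpq' := sub_ne_zero.mpr hpq
  rw [Fintype.linearIndependent_iff]
  intro w hw
  change ∑ i, w i • grad (![H0, K0, J1, J2] i) m = 0 at hw
  simp only [Fin.sum_univ_four, cons_val, grad_H0, grad_K0, grad_J1, grad_J2] at hw
  have hb : ∀ i, w 0 + w 1 * (cc m (i + 1) * cc m (i + 3)) = 0 := fun i => by
    simpa [vec] using congrFun hw (Sum.inl i)
  have hw1 : w 1 = 0 := by
    refine (mul_eq_zero.mp ?_).resolve_right hpq'
    have hb0 : w 0 + w 1 * (cc m 1 * cc m 3) = 0 := hb 0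
    have hb1 : w 0 + w 1 * (cc m 2 * cc m 0) = 0 := hb 1
    linear_combination hb1 - hb0
  have hw0 : w 0 = 0 := by simpa [hw1] using hb 0
  have hc : ∀ i, w 2 * cc m (i + 2) + w 3 * (cc m (i + 1) * cc m (i + 2) * cc m (i + 3)) = 0 :=
    fun i => by simpa [vec, hw0, hw1] using congrFun hw (Sum.inr (Sum.inr i))
  have hw3 : w 3 = 0 := by
    refine (mul_eq_zero.mp ?_).resolve_right (mul_ne_zero (mul_ne_zero h2 h3) hpq')
    have hc0 : w 2 * cc m 2 + w 3 * (cc m 1 * cc m 2 * cc m 3) = 0 := hc 0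
    have hc1 : w 2 * cc m 3 + w 3 * (cc m 2 * cc m 3 * cc m 0) = 0 := hc 1
    linear_combination cc m 2 * hc1 - cc m 3 * hc0
  have hw2 : w 2 = 0 := by simpa [hw3, h2] using hc 0
  intro i
  fin_cases i
  exacts [hw0, hw1, hw2, hw3]

theorem eq_zero_of_mul_eq_mul {K : Type*} [Field K] {a c : Fin 4 → K} (hc : ∀ i, c i ≠ 0)
    (hpq : c 0 * c 2 ≠ c 1 * c 3) (h : ∀ i, c (i + 3) * a (i + 3) = c i * a (i + 1)) (i : Fin 4) :
    a i = 0 := by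
  have hpq' := sub_ne_zero.mpr hpq
  have h0 : c 3 * a 3 = c 0 * a 1 := h 0
  have h1 : c 0 * a 0 = c 1 * a 2 := h 1
  have h2 : c 1 * a 1 = c 2 * a 3 := h 2
  have h3 : c 2 * a 2 = c 3 * a 0 := h 3
  have ha0 : a 0 = 0 := by
    refine (mul_eq_zero.mp ?_).resolve_left hpq'
    linear_combination c 2 * h1 + c 1 * h3
  have ha1 : a 1 = 0 := by
    refine (mul_eq_zero.mp ?_).resolve_left hpq'
    linear_combination -c 2 * h0 - c 3 * h2
  fin_cases i
  exacts [ha0, ha1, by simpa [ha0, hc] using h3, by simpa [ha1, hc] using h0]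

theorem eq_zero_of_bivP_mulVec_eq_zero (hc : ∀ i, cc m i ≠ 0)
    (hpq : cc m 0 * cc m 2 ≠ cc m 1 * cc m 3) {v : Phase} (hv : bivP m *ᵥ v = 0)
    (hb0 : bc v 0 = 0) (hb1 : bc v 1 = 0) (hc2 : cc v 2 = 0) (hc3 : cc v 3 = 0) : v = 0 := by
  rw [bivP_mulVec] at hv
  have hcc : ∀ i, bc v i = bc v (i + 2) := fun i =>
    sub_eq_zero.mp ((mul_eq_zero.mp (congrFun hv (Sum.inr (Sum.inr i)))).resolve_left (hc i))
  have hb : ∀ i, bc v i = 0 := by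
    intro i
    fin_cases i
    exacts [hb0, hb1, (hcc 2).trans hb0, (hcc 3).trans hb1]
  have ha : ∀ i, ac v i = 0 := eq_zero_of_mul_eq_mul hc hpq fun i => by
    have h : ac m i * (bc v i - bc v (i + 1)) + cc m (i + 3) * ac v (i + 3)
      - cc m i * ac v (i + 1) = 0 := congrFun hv (Sum.inr (Sum.inl i))
    simpa [hb, sub_eq_zero] using h
  have hbb : ∀ i, cc m (i + 2) * cc v (i + 2) = cc m i * cc v i := fun i => by
    have h : ac m (i + 3) * ac v (i + 3) - ac m i * ac v i + cc m (i + 2) * cc v (i + 2)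
      - cc m i * cc v i = 0 := congrFun hv (Sum.inl i)
    simpa [ha, sub_eq_zero] using h
  refine phase_ext hb ha fun i => ?_
  change cc v i = 0
  fin_cases i
  exacts [by simpa [hc2, hc] using hbb 0, by simpa [hc3, hc] using hbb 1, hc2, hc3]

theorem finrank_ker_bivP_le (hc : ∀ i, cc m i ≠ 0)
    (hpq : cc m 0 * cc m 2 ≠ cc m 1 * cc m 3) :
    Module.finrank ℂ (LinearMap.ker (bivP m).mulVecLin) ≤ 4 := by
  let coords : Phase →ₗ[ℂ] (Fin 4 → ℂ) :=
    LinearMap.funLeft ℂ ℂ ![Sum.inl 0, Sum.inl 1, Sum.inr (Sum.inr 2), Sum.inr (Sum.inr 3)]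
  have hinj : Function.Injective (coords.domRestrict (LinearMap.ker (bivP m).mulVecLin)) := by
    refine (injective_iff_map_eq_zero _).mpr fun v hv => Subtype.ext ?_
    exact eq_zero_of_bivP_mulVec_eq_zero hc hpq v.2 (congrFun hv 0) (congrFun hv 1)
      (congrFun hv 2) (congrFun hv 3)
  simpa using LinearMap.finrank_le_finrank_of_injective hinj

theorem isSymplecticAt_of_cc_ne (hc : ∀ i, cc m i ≠ 0)
    (hpq : cc m 0 * cc m 2 ≠ cc m 1 * cc m 3) : IsSymplecticAt m := by
  have hs := surjective_fderiv_casimirs (linearIndependent_grad_casimirs (hc 2) (hc 3) hpq)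
  have hle : LinearMap.range (bivP m).mulVecLin ≤ leafTangent m := by
    rintro _ ⟨g, rfl⟩
    exact bivP_mulVec_mem_leafTangent m g
  have hrank := LinearMap.finrank_range_add_finrank_ker (bivP m).mulVecLin
  have hker := finrank_ker_bivP_le hc hpq
  rw [Module.finrank_fintype_fun_eq_card, Fintype.card_sum, Fintype.card_sum,
    Fintype.card_fin] at hrank
  have heq := Submodule.eq_of_le_of_finrank_le hle (by rw [finrank_leafTangent hs]; lia)
  refine ⟨hs, ?_⟩
  rw [← heq, LinearMap.coe_range]
  ext v
  constructor
  · rintro ⟨α, rfl⟩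
    exact ⟨fun t => α (Pi.single t 1), rfl⟩
  · rintro ⟨g, rfl⟩
    exact ⟨covec g, sharp_covec _ g⟩

theorem cc_ne_of_mem_leaf {κ : Fin 4 → ℂ} (h3 : κ 3 ≠ 0) (hd : κ 2 ^ 2 ≠ 4 * κ 3)
    (hm : m ∈ leaf κ) : (∀ i, cc m i ≠ 0) ∧ cc m 0 * cc m 2 ≠ cc m 1 * cc m 3 := by
  have hJ1 : cc m 0 * cc m 2 + cc m 1 * cc m 3 = κ 2 := congrFun hm 2
  have hJ2 : cc m 0 * cc m 1 * cc m 2 * cc m 3 = κ 3 := congrFun hm 3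
  constructor
  · simp only [← hJ2, mul_ne_zero_iff] at h3
    intro i
    fin_cases i
    exacts [h3.1.1.1, h3.1.1.2, h3.1.2, h3.2]
  · intro h
    refine hd ?_
    rw [← hJ1, ← hJ2]
    linear_combination (cc m 0 * cc m 2 - cc m 1 * cc m 3) * h

end GenericLeaves

/-! ### Density of the regular points -/

section Density

open MvPolynomial

/-- The values of the Casimirs at a point where `H₀ = k 0`, `K₀ = k 1`, `c₁ c₃ = k 2` and
`c₂ c₄ = k 3`. -/
def casimirValues (k : Fin 4 → ℂ) : Fin 4 → ℂ := ![k 0, k 1, k 2 + k 3, k 2 * k 3]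

theorem casimirValues_comp_swap (k : Fin 4 → ℂ) :
    casimirValues (k ∘ Equiv.swap 2 3) = casimirValues k := by
  have e0 : Equiv.swap (2 : Fin 4) 3 0 = 0 := by decide
  have e1 : Equiv.swap (2 : Fin 4) 3 1 = 1 := by decide
  simp only [casimirValues, Function.comp_apply, e0, e1, Equiv.swap_apply_left,
    Equiv.swap_apply_right, add_comm (k 3), mul_comm (k 3)]

theorem exists_eval_eq_add_mul (P : MvPolynomial (Fin 4) ℂ) :
    ∃ U W : MvPolynomial (Fin 4) ℂ, ∀ k,
      eval k P = eval (casimirValues k) U + eval (casimirValues k) W * k 2 := by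
  induction P using MvPolynomial.induction_on with
  | C a => exact ⟨C a, 0, by simp⟩
  | add P Q hP hQ =>
    obtain ⟨U, W, h⟩ := hP
    obtain ⟨U', W', h'⟩ := hQ
    refine ⟨U + U', W + W', fun k => ?_⟩
    simp only [map_add, h, h']
    ring
  | mul_X P i hP =>
    obtain ⟨U, W, h⟩ := hP
    -- `k 2` and `k 3` are the roots of `t² - σ t + τ`, where `σ, τ` are the last two values.
    have hreduce : ∃ U' W' : MvPolynomial (Fin 4) ℂ, ∀ k,
        (eval (casimirValues k) U + eval (casimirValues k) W * k 2) * k i =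
          eval (casimirValues k) U' + eval (casimirValues k) W' * k 2 := by
      fin_cases i
      · refine ⟨U * X 0, W * X 0, fun k => ?_⟩
        simp only [Fin.zero_eta, map_mul, eval_X, casimirValues, cons_val]
        ring
      · refine ⟨U * X 1, W * X 1, fun k => ?_⟩
        simp only [Fin.mk_one, map_mul, eval_X, casimirValues, cons_val]
        ring
      · refine ⟨-W * X 3, U + W * X 2, fun k => ?_⟩
        simp only [Fin.reduceFinMk, map_mul, map_add, map_neg, eval_X, casimirValues, cons_val]
        ring
      · refine ⟨U * X 2 + W * X 3, -U, fun k => ?_⟩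
        simp only [Fin.reduceFinMk, map_mul, map_add, map_neg, eval_X, casimirValues, cons_val]
        ring
    simpa only [map_mul, eval_X, h] using hreduce

/-- `E` is the norm of `P` over the polynomials in the symmetric functions of `k 2` and `k 3`. -/
theorem exists_symmetric_norm {P : MvPolynomial (Fin 4) ℂ} (hP : P ≠ 0) :
    ∃ E : MvPolynomial (Fin 4) ℂ, E ≠ 0 ∧ ∀ k, eval (casimirValues k) E ≠ 0 → eval k P ≠ 0 := by
  obtain ⟨U, W, h⟩ := exists_eval_eq_add_mul P
  have hnorm : ∀ k, eval (casimirValues k) (U ^ 2 + U * W * X 2 + W ^ 2 * X 3) =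
      eval k (P * rename (Equiv.swap 2 3) P) := fun k => by
    rw [map_mul, eval_rename, h, h, casimirValues_comp_swap, Function.comp_apply,
      Equiv.swap_apply_left]
    simp only [map_add, map_mul, map_pow, eval_X]
    simp only [show casimirValues k 2 = k 2 + k 3 from rfl,
      show casimirValues k 3 = k 2 * k 3 from rfl]
    ring
  have hP' : rename (Equiv.swap 2 3) P ≠ 0 :=
    ((rename_injective _ (Equiv.swap 2 3).injective).ne_iff' (map_zero _)).mpr hP
  refine ⟨U ^ 2 + U * W * X 2 + W ^ 2 * X 3, fun hE => ?_, fun k hk => ?_⟩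
  · refine mul_ne_zero hP hP' (MvPolynomial.funext fun k => ?_)
    rw [← hnorm, hE, map_zero, map_zero]
  · rw [hnorm, map_mul] at hk
    exact left_ne_zero_of_mul hk

/-- The value of `b₁ + b₃` at a point with the given `a`, `c` where `H₀ = k 0`, `K₀ = k 1`,
`c₁ c₃ = k 2` and `c₂ c₄ = k 3`; it solves the equations `H₀ = k 0`, `K₀ = k 1`, which are linear
in `b`. -/
def oddSum (k a c : Fin 4 → ℂ) : ℂ :=
  (k 1 - k 2 * k 0 + (c 0 * a 3 * a 2 + c 1 * a 0 * a 3 + c 2 * a 1 * a 0 + c 3 * a 2 * a 1)) /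
    (k 3 - k 2)

/-- The point with coordinates `a`, `c` and `β = (b₁, b₂)` where `H₀ = k 0` and `K₀ = k 1`, provided
that `c₁ c₃ = k 2` and `c₂ c₄ = k 3`. -/
def leafPoint (k a c : Fin 4 → ℂ) (β : Fin 2 → ℂ) : Phase :=
  vec ![β 0, β 1, oddSum k a c - β 0, k 0 - oddSum k a c - β 1] a c

theorem casimirs_leafPoint {k c : Fin 4 → ℂ} (hk : k 2 ≠ k 3) (h2 : c 0 * c 2 = k 2)
    (h3 : c 1 * c 3 = k 3) (a : Fin 4 → ℂ) (β : Fin 2 → ℂ) :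
    casimirs (leafPoint k a c β) = casimirValues k := by
  have hs : oddSum k a c * (k 3 - k 2) = _ := div_mul_cancel₀ _ (sub_ne_zero.mpr hk.symm)
  ext i
  fin_cases i <;>
    simp only [casimirs, casimirValues, H0, K0, J1, J2, leafPoint, Fin.sum_univ_four, Fin.zero_eta,
      Fin.mk_one, Fin.reduceFinMk, Fin.isValue, Fin.reduceAdd, zero_add, cons_val, bc_vec, ac_vec,
      cc_vec]
  · ring
  · linear_combination hs + (k 0 - oddSum k a c) * h2 + oddSum k a c * h3
  · linear_combination h2 + h3
  · linear_combination c 1 * c 3 * h2 + k 2 * h3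

theorem leafPoint_eq_self {m : Phase} {k : Fin 4 → ℂ} (hk : k 2 ≠ k 3) (h0 : H0 m = k 0)
    (h1 : K0 m = k 1) (h2 : cc m 0 * cc m 2 = k 2) (h3 : cc m 1 * cc m 3 = k 3) :
    leafPoint k (ac m) (cc m) ![bc m 0, bc m 1] = m := by
  have hs : oddSum k (ac m) (cc m) = bc m 0 + bc m 2 := by
    rw [oddSum, div_eq_iff (sub_ne_zero.mpr hk.symm), ← h0, ← h1, ← h2, ← h3]
    simp only [K0, H0, Fin.sum_univ_four, Fin.isValue, Fin.reduceAdd, zero_add]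
    ring
  refine phase_ext (fun i => ?_) (fun _ => rfl) fun _ => rfl
  rw [leafPoint, hs, ← h0, H0, Fin.sum_univ_four, bc_vec]
  fin_cases i <;> simp only [Fin.zero_eta, Fin.mk_one, Fin.reduceFinMk, cons_val] <;> ring

theorem leafPoint_eq_basePoint (k : Fin 4 → ℂ) :
    leafPoint k ![1, 0, 0, k 0 * k 2 - k 1] ![1, 1, k 2, k 3] 0 = basePoint k := by
  have hs : oddSum k ![1, 0, 0, k 0 * k 2 - k 1] ![1, 1, k 2, k 3] = 0 := by
    simp only [oddSum, cons_val]
    ring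
  simp [leafPoint, basePoint, hs]

/-- The coordinates `(c₁, …, c₄)` with `c₁ = exp γ₁`, `c₂ = exp γ₂`, `c₁ c₃ = p` and `c₂ c₄ = q`. -/
def expCoords (p q : ℂ) (γ : Fin 2 → ℂ) : Fin 4 → ℂ :=
  ![Complex.exp (γ 0), Complex.exp (γ 1), p * Complex.exp (-γ 0), q * Complex.exp (-γ 1)]

theorem expCoords_zero_mul_two (p q : ℂ) (γ : Fin 2 → ℂ) :
    expCoords p q γ 0 * expCoords p q γ 2 = p := by
  change Complex.exp (γ 0) * (p * Complex.exp (-γ 0)) = p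
  rw [mul_left_comm, ← Complex.exp_add, add_neg_cancel, Complex.exp_zero, mul_one]

theorem expCoords_one_mul_three (p q : ℂ) (γ : Fin 2 → ℂ) :
    expCoords p q γ 1 * expCoords p q γ 3 = q := by
  change Complex.exp (γ 1) * (q * Complex.exp (-γ 1)) = q
  rw [mul_left_comm, ← Complex.exp_add, add_neg_cancel, Complex.exp_zero, mul_one]

theorem expCoords_log {c : Fin 4 → ℂ} (h0 : c 0 ≠ 0) (h1 : c 1 ≠ 0) :
    expCoords (c 0 * c 2) (c 1 * c 3) ![Complex.log (c 0), Complex.log (c 1)] = c := by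
  have h2 : c 0 * c 2 * (c 0)⁻¹ = c 2 := by field_simp
  have h3 : c 1 * c 3 * (c 1)⁻¹ = c 3 := by field_simp
  ext i
  fin_cases i <;>
    simp [expCoords, Complex.exp_neg, Complex.exp_log h0, Complex.exp_log h1, h2, h3]

theorem differentiable_leafPoint (k : Fin 4 → ℂ) {a : ℂ → Fin 4 → ℂ} {β γ : ℂ → Fin 2 → ℂ}
    (ha : ∀ i, Differentiable ℂ fun u => a u i) (hβ : ∀ i, Differentiable ℂ fun u => β u i)
    (hγ : ∀ i, Differentiable ℂ fun u => γ u i) :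
    Differentiable ℂ fun u => leafPoint k (a u) (expCoords (k 2) (k 3) (γ u)) (β u) := by
  refine differentiable_pi.mpr fun t => ?_
  rcases t with t | t | t <;> fin_cases t <;>
    simp only [leafPoint, oddSum, expCoords, vec, Sum.elim_inl, Sum.elim_inr, Fin.zero_eta,
      Fin.mk_one, Fin.reduceFinMk, cons_val] <;>
    fun_prop

open Filter Topology in
theorem mem_closure_ne_zero {E : Type*} [NormedAddCommGroup E] [NormedSpace ℂ E] {F : E → ℂ}
    (hF : Differentiable ℂ F) {path : ℂ → E} (hpath : Differentiable ℂ path)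
    (h1 : F (path 1) ≠ 0) : path 0 ∈ closure {x | x ∈ Set.range path ∧ F x ≠ 0} := by
  have han : AnalyticOnNhd ℂ (F ∘ path) Set.univ := fun u _ => (hF.comp hpath).analyticAt u
  have hev : ∀ᶠ u in 𝓝[≠] (0 : ℂ), F (path u) ≠ 0 :=
    (han 0 trivial).eventually_eq_zero_or_eventually_ne_zero.resolve_left fun hz =>
      h1 (han.eqOn_zero_of_preconnected_of_eventuallyEq_zero isPreconnected_univ
        (Set.mem_univ 0) hz (Set.mem_univ 1))
  exact mem_closure_of_tendsto ((hpath 0).continuousAt.tendsto.mono_left nhdsWithin_le_nhds)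
    (hev.mono fun u hu => ⟨Set.mem_range_self u, hu⟩)

theorem leafPoint_mem_closure {k : Fin 4 → ℂ} (hk : k 2 ≠ k 3)
    (hb : regularizer (basePoint k) ≠ 0) (a : Fin 4 → ℂ) (β γ : Fin 2 → ℂ) :
    leafPoint k a (expCoords (k 2) (k 3) γ) β ∈
      closure (leaf (casimirValues k) ∩ regularSet) := by
  let a₁ : Fin 4 → ℂ := ![1, 0, 0, k 0 * k 2 - k 1]
  let path : ℂ → Phase := fun u =>
    leafPoint k (a + u • (a₁ - a)) (expCoords (k 2) (k 3) ((1 - u) • γ)) ((1 - u) • β)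
  have hpath : Differentiable ℂ path := differentiable_leafPoint k
    (fun i => by simp only [Pi.add_apply, Pi.smul_apply]; fun_prop)
    (fun i => by simp only [Pi.smul_apply]; fun_prop)
    (fun i => by simp only [Pi.smul_apply]; fun_prop)
  have h0 : path 0 = leafPoint k a (expCoords (k 2) (k 3) γ) β := by simp [path]
  have h1 : path 1 = basePoint k := by
    rw [← leafPoint_eq_basePoint k]
    simp [path, a₁, expCoords]
  rw [← h0]
  refine closure_mono ?_
    (mem_closure_ne_zero isPoly_regularizer.differentiable hpath (h1.symm ▸ hb))
  rintro _ ⟨⟨u, rfl⟩, hu⟩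
  exact ⟨casimirs_leafPoint hk (expCoords_zero_mul_two ..) (expCoords_one_mul_three ..) _ _,
    mem_regularSet_of_regularizer_ne_zero hu⟩

theorem casimirs_basePoint (k : Fin 4 → ℂ) : casimirs (basePoint k) = casimirValues k := by
  ext i
  fin_cases i <;>
    simp [casimirs, casimirValues, basePoint, H0, K0, J1, J2, bc_vec, ac_vec, cc_vec,
      Fin.sum_univ_four]

/-- `c₁ c₃` and `c₂ c₄` are the roots of `t² - J₁ t + J₂`. -/
theorem leaf_nonempty (κ : Fin 4 → ℂ) : (leaf κ).Nonempty := by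
  obtain ⟨s, hs⟩ := IsAlgClosed.exists_eq_mul_self (κ 2 ^ 2 - 4 * κ 3)
  refine ⟨basePoint ![κ 0, κ 1, (κ 2 + s) / 2, (κ 2 - s) / 2], (casimirs_basePoint _).trans ?_⟩
  ext i
  fin_cases i <;> simp only [casimirValues, Fin.zero_eta, Fin.mk_one, Fin.reduceFinMk, cons_val]
  · ring
  · linear_combination hs / 4

theorem leaf_subset_closure {κ : Fin 4 → ℂ} (h3 : κ 3 ≠ 0) (hd : κ 2 ^ 2 ≠ 4 * κ 3)
    (hb : ∀ k, casimirValues k = κ → regularizer (basePoint k) ≠ 0) :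
    leaf κ ⊆ closure (leaf κ ∩ regularSet) := by
  intro m hm
  obtain ⟨hc, hpq⟩ := cc_ne_of_mem_leaf h3 hd hm
  let k : Fin 4 → ℂ := ![κ 0, κ 1, cc m 0 * cc m 2, cc m 1 * cc m 3]
  have hk : casimirValues k = κ := by
    ext i
    fin_cases i
    · rfl
    · rfl
    · exact congrFun hm 2
    · refine Eq.trans ?_ (congrFun hm 3)
      change cc m 0 * cc m 2 * (cc m 1 * cc m 3) = cc m 0 * cc m 1 * cc m 2 * cc m 3
      ring
  have hmem := leafPoint_mem_closure (k := k) hpq (hb k hk) (ac m) ![bc m 0, bc m 1]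
    ![Complex.log (cc m 0), Complex.log (cc m 1)]
  rwa [hk, show expCoords (k 2) (k 3) _ = cc m from expCoords_log (hc 0) (hc 1),
    leafPoint_eq_self (k := k) hpq (congrFun hm 0) (congrFun hm 1) rfl rfl] at hmem

theorem exists_generic : ∃ E : MvPolynomial (Fin 4) ℂ, E ≠ 0 ∧ ∀ κ, eval κ E ≠ 0 →
    (leaf κ).Nonempty ∧ (∀ m ∈ leaf κ, IsSymplecticAt m) ∧
      leaf κ ⊆ closure (leaf κ ∩ regularSet) := by
  obtain ⟨P, hP⟩ := isPoly_regularizer.comp isPoly_basePoint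
  have hP0 : P ≠ 0 := by
    rintro rfl
    exact regularizer_basePoint_ne_zero ((hP _).trans (map_zero _))
  obtain ⟨E, hE, hEP⟩ := exists_symmetric_norm hP0
  have hd : (X 2 ^ 2 - 4 * X 3 : MvPolynomial (Fin 4) ℂ) ≠ 0 := fun h => by
    simpa using congrArg (eval ![0, 0, 1, 0]) h
  refine ⟨E * X 3 * (X 2 ^ 2 - 4 * X 3), mul_ne_zero (mul_ne_zero hE (X_ne_zero 3)) hd,
    fun κ hκ => ?_⟩
  simp only [map_mul, mul_ne_zero_iff, eval_X, map_sub, map_pow, map_ofNat, sub_ne_zero] at hκ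
  obtain ⟨⟨hκE, h3⟩, hκd⟩ := hκ
  refine ⟨leaf_nonempty κ, fun m hm => ?_, leaf_subset_closure h3 hκd fun k hk h0 => ?_⟩
  · obtain ⟨hc, hpq⟩ := cc_ne_of_mem_leaf h3 hκd hm
    exact isSymplecticAt_of_cc_ne hc hpq
  · exact hEP k (hk.symm ▸ hκE) ((hP k).symm.trans h0)

end Density

end TodaFourThree

end

theorem mainTheorem7 :
    -- the Toda Hamiltonian belongs to the family, and the spectral curve has the expansion `R`
    (∀ m, TodaFourThree.todaH m
      = (1 / 2) * TodaFourThree.H0 m ^ 2 - TodaFourThree.H1 m) ∧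
    (∀ (m : TodaFourThree.Phase) (x ν : ℂ), ν ≠ 0 →
      (x • (1 : Matrix (Fin 4) (Fin 4) ℂ) - TodaFourThree.lax m ν).det
        = TodaFourThree.spectralFun (TodaFourThree.casimirs m) (TodaFourThree.hams m) x (ν ^ 4)) ∧
    -- the generic level set is a symplectic leaf in which the regular points are dense
    (∃ E : MvPolynomial (Fin 4) ℂ, E ≠ 0 ∧ ∀ κ : Fin 4 → ℂ, MvPolynomial.eval κ E ≠ 0 →
      (TodaFourThree.leaf κ).Nonempty ∧
      (∀ m ∈ TodaFourThree.leaf κ, TodaFourThree.IsSymplecticAt m) ∧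
      TodaFourThree.leaf κ ⊆ closure (TodaFourThree.leaf κ ∩ TodaFourThree.regularSet)) ∧
    -- near each regular point, branches of `(λ, μ)` exist and form a chart of the leaf
    (∀ κ : Fin 4 → ℂ, ∀ m ∈ TodaFourThree.leaf κ ∩ TodaFourThree.regularSet,
      ∃ (V : Set TodaFourThree.Phase) (lam mu : Fin 4 → TodaFourThree.Phase → ℂ),
        m ∈ V ∧ V ⊆ TodaFourThree.regularSet ∧ TodaFourThree.IsBranch V lam mu ∧
        Set.InjOn (fun p => ((fun i => lam i p, fun i => mu i p) : (Fin 4 → ℂ) × (Fin 4 → ℂ)))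
          (V ∩ TodaFourThree.leaf κ) ∧
        IsOpen ((fun p => ((fun i => lam i p, fun i => mu i p) : (Fin 4 → ℂ) × (Fin 4 → ℂ))) ''
          (V ∩ TodaFourThree.leaf κ))) ∧
    -- any branches are DN coordinates, and the spectral curve gives the separation relations
    (∀ (V : Set TodaFourThree.Phase) (lam mu : Fin 4 → TodaFourThree.Phase → ℂ),
      TodaFourThree.IsBranch V lam mu → ∀ κ : Fin 4 → ℂ,
        (∀ m ∈ V ∩ TodaFourThree.leaf κ ∩ TodaFourThree.regularSet,
          TodaFourThree.IsSymplecticAt m ∧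
          TodaFourThree.IsIntegrableAt m ∧
          TodaFourThree.IsDarbouxNijenhuisAt lam mu m ∧
          ∀ (i : Fin 4) (ν : ℂ), ν ^ 4 = Complex.exp (mu i m) →
            (lam i m • (1 : Matrix (Fin 4) (Fin 4) ℂ) - TodaFourThree.lax m ν).det = 0) ∧
        TodaFourThree.IsSeparatedBy (V ∩ TodaFourThree.leaf κ ∩ TodaFourThree.regularSet)
          lam mu TodaFourThree.hams
          (fun _ x y h => TodaFourThree.spectralFun κ h x (Complex.exp y))) := by
  refine ⟨TodaFourThree.todaH_eq, TodaFourThree.det_lax, TodaFourThree.exists_generic, ?_, ?_⟩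
  · rintro κ m ⟨-, hm⟩
    obtain ⟨V, lam, mu, hV, hVr, hB, hκ⟩ := TodaFourThree.exists_chart hm
    exact ⟨V, lam, mu, hV, hVr, hB, hκ κ⟩
  · intro V lam mu hB κ
    refine ⟨?_, hB.isSeparatedBy κ⟩
    rintro m ⟨⟨hm, -⟩, hr⟩
    exact ⟨hB.isSymplecticAt hm hr, TodaFourThree.isIntegrableAt hr, hB.isDarbouxNijenhuisAt hm hr,
      fun i ν hν => hB.det_lax_eq_zero hm i hν⟩
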